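/- A $4$-graph is a finite hypergraph all of whose edges are $4$-element sets of vertices. For a family $\mathcal F$ of $4$-graphs, a $4$-graph is $\mathcal F$-free if it contains no member of $\mathcal F$ as a (not necessarily induced) sub-hypergraph; $\mathrm{ex}(n,\mathcal F)$ is the maximum number of edges of an $\mathcal F$-free $4$-graph on $n$ vertices, and $\pi(\mathcal F)=\lim_{n\to\infty}\mathrm{ex}(n,\mathcal F)/\binom n4$. Let $P=(\{1,2\},\{\{1,1,2,2\}\})$; a $4$-graph $H$ is $P$-colorable if there is a map $\phi:V(H)\to\{1,2\}$ such that every edge has exactly two vertices with $\phi=1$ and exactly two with $\phi=2$, and $\mathrm{Col}(P)$ is the class of all $P$-colorable $4$-graphs. For a $4$-graph $G$ with vertex set $\{1,\dots,n\}$ and a real number $\alpha>1$ let $$\lambda_\alpha(G)=\max\Big\{4!\sum_{\{i_1,i_2,i_3,i_4\}\in E(G)}x_{i_1}x_{i_2}x_{i_3}x_{i_4}\ :\ x\in\mathbb R^n,\ \Big(\sum_{i=1}^n|x_i|^\alpha\Big)^{1/\alpha}=1\Big\}.$$ Let $B_4(n)$ be the $4$-graph whose vertex set is the disjoint union of two parts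 of sizes $\lfloor n/2\rfloor$ and $\lceil n/2\rceil$ and whose edges are all $4$-sets with exactly two vertices in each part. **Theorem.** Let $\mathcal F$ be a family of $4$-graphs such that (i) $(\mathcal F,P)$ is a Turán pair: every $P$-colorable $4$-graph is $\mathcal F$-free, and for all sufficiently large $n$ every $\mathcal F$-free $4$-graph on $n$ vertices with $\mathrm{ex}(n,\mathcal F)$ edges is $P$-colorable; and (ii) $\mathcal F$ is degree-stable with respect to $\mathrm{Col}(P)$: there exist $\varepsilon>0$ and $n_1$ such that every $\mathcal F$-free $4$-graph $H$ on $n\ge n_1$ vertices with minimum degree $\delta(H)\ge(\pi(\mathcal F)/3!-\varepsilon)n^{3}$ is $P$-colorable. Then for every $\alpha>1$ there exists $n_0$ such that every $\mathcal F$-free $4$-graph $G$ on $n>n_0$ vertices satisfies $\lambda_\alpha(G)\le\lambda_\alpha(B_4(n))$, with equality if and only if $G$ is isomorphic to $B_4(n)$. -/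

import Mathlib

open Filter Topology

/-- A (finite, simple) `k`-graph on the vertex type `V`: a finite set of edges, each of which is a
set of exactly `k` vertices. -/
@[ext]
structure KGraph (k : ℕ) (V : Type*) where
  edges : Finset (Finset V)
  uniform : ∀ e ∈ edges, e.card = k

namespace KGraph

variable {k : ℕ} {V W : Type*}

/-- `H` contains a copy of `F` as a (not necessarily induced) sub-hypergraph. -/
def Contains (H : KGraph k V) (F : KGraph k W) : Prop :=
  ∃ f : W ↪ V, ∀ e ∈ F.edges, e.map f ∈ H.edges

/-- Isomorphism of `k`-graphs. -/
def Iso (G : KGraph k V) (H : KGraph k W) : Prop :=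
  ∃ f : V ≃ W, ∀ e : Finset V, e ∈ G.edges ↔ e.map f.toEmbedding ∈ H.edges

/-- The degree of a vertex: the number of edges containing it. -/
def degree [DecidableEq V] (H : KGraph k V) (v : V) : ℕ :=
  (H.edges.filter (fun e => v ∈ e)).card

/-- The minimum degree. -/
noncomputable def minDegree [DecidableEq V] (H : KGraph k V) : ℕ :=
  ⨅ v : V, H.degree v

/-- The Lagrangian polynomial `P_G(x) = k! ∑_{e ∈ E(G)} ∏_{v ∈ e} x_v`. -/
noncomputable def lagrangian (G : KGraph k V) (x : V → ℝ) : ℝ :=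
  (Nat.factorial k : ℝ) * ∑ e ∈ G.edges, ∏ v ∈ e, x v

/-- The `α`-spectral radius: the maximum of the Lagrangian polynomial over the unit sphere of the
`ℓ_α`-norm. (For `α ≥ 1` and `V` finite and nonempty the sphere is compact and nonempty, so that
the supremum is a maximum.) -/
noncomputable def spectralRadius [Fintype V] (α : ℝ) (G : KGraph k V) : ℝ :=
  sSup (G.lagrangian '' {x : V → ℝ | (∑ v, |x v| ^ α) ^ (1 / α) = 1})

end KGraph

/-- Families (or classes) of finite `k`-graphs. Every finite `k`-graph is isomorphic to one on some
`Fin n`. -/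
abbrev KFamily (k : ℕ) := Set (Σ n : ℕ, KGraph k (Fin n))

/-- `H` is `𝓕`-free: it contains no member of `𝓕`. -/
def KGraph.Free {k : ℕ} {V : Type*} (H : KGraph k V) (𝓕 : KFamily k) : Prop :=
  ∀ F ∈ 𝓕, ¬ H.Contains F.2

/-- The Turán number `ex(n, 𝓕)`: the maximum number of edges of an `𝓕`-free `k`-graph on `n`
vertices. -/
noncomputable def turanNumber {k : ℕ} (n : ℕ) (𝓕 : KFamily k) : ℕ :=
  sSup {m : ℕ | ∃ H : KGraph k (Fin n), H.Free 𝓕 ∧ H.edges.card = m}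

/-- The Turán density `π(𝓕) = lim ex(n, 𝓕) / (n choose k)`. -/
noncomputable def turanDensity {k : ℕ} (𝓕 : KFamily k) : ℝ :=
  limUnder atTop (fun n : ℕ => (turanNumber n 𝓕 : ℝ) / (n.choose k : ℝ))

/-- A `k`-pattern `([l], E)`: a collection `E` of `k`-multisets with elements from a set of
`l ≥ 1` colors. -/
structure KPattern (k : ℕ) where
  l : ℕ
  pos : 0 < l
  edges : Set (Multiset (Fin l))
  uniform : ∀ s ∈ edges, Multiset.card s = k

/-- `H` is `P`-colorable: there is a homomorphism from `H` to the pattern `P`. -/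
def KGraph.Colorable {k : ℕ} {V : Type*} (H : KGraph k V) (P : KPattern k) : Prop :=
  ∃ φ : V → Fin P.l, ∀ e ∈ H.edges, e.val.map φ ∈ P.edges

/-- `Col(P)`, the class of all `P`-colorable `k`-graphs. -/
def KPattern.Col {k : ℕ} (P : KPattern k) : KFamily k :=
  {H | H.2.Colorable P}

/-- `(𝓕, P)` is a Turán pair: every `P`-colorable `k`-graph is `𝓕`-free and, for all sufficiently
large `n`, every `𝓕`-free `k`-graph on `n` vertices with the maximum number of edges is
`P`-colorable. (Requiring the second part for all `n` would give a more restrictive notion.) -/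
def IsTuranPair {k : ℕ} (𝓕 : KFamily k) (P : KPattern k) : Prop :=
  (∀ (n : ℕ) (H : KGraph k (Fin n)), H.Colorable P → H.Free 𝓕) ∧
  ∃ n₀ : ℕ, ∀ n ≥ n₀, ∀ H : KGraph k (Fin n),
    H.Free 𝓕 → H.edges.card = turanNumber n 𝓕 → H.Colorable P

/-- `𝓕` is degree-stable with respect to the class `ℌ`. -/
def IsDegreeStable {k : ℕ} (𝓕 ℌ : KFamily k) : Prop :=
  ∃ ε : ℝ, 0 < ε ∧ ∃ n₀ : ℕ, ∀ n ≥ n₀, ∀ H : KGraph k (Fin n), H.Free 𝓕 →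
    (turanDensity 𝓕 / (Nat.factorial (k - 1) : ℝ) - ε) * (n : ℝ) ^ (k - 1) ≤ (H.minDegree : ℝ) →
    (⟨n, H⟩ : Σ n : ℕ, KGraph k (Fin n)) ∈ ℌ

/-- The `4`-pattern `({1,2}, {{1,1,2,2}})`; the two colors are called `0` and `1` here. -/
def patternB4 : KPattern 4 where
  l := 2
  pos := by decide
  edges := {({0, 0, 1, 1} : Multiset (Fin 2))}
  uniform := by
    intro s hs
    rw [Set.mem_singleton_iff.mp hs]
    rfl

/-- `B₄(n)`, the complete balanced bipartite-like `4`-graph on `n` vertices: the parts are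
`{v | v < ⌊n/2⌋}` and its complement, and the edges are all `4`-sets with exactly two vertices in
each part. -/
def B4 (n : ℕ) : KGraph 4 (Fin n) where
  edges := Finset.univ.filter (fun e : Finset (Fin n) =>
    (e.filter (fun v => v.val < n / 2)).card = 2 ∧
    (e.filter (fun v => ¬ v.val < n / 2)).card = 2)
  uniform := by
    intro e he
    have h := (Finset.mem_filter.mp he).2
    rw [← Finset.card_filter_add_card_filter_not (s := e) (fun v => v.val < n / 2), h.1, h.2]

/-!
Write `k = 4`. Let `ρ(G)` be the `α`-spectral radius of a free `G` on `n` vertices, attained at a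
nonnegative unit vector `x`, and suppose that `ρ(G) ≥ ρ(B₄(n)) ∼ 3/8 n ^ (k - k/α)`.

If some vertex is light, `n x_v ^ α ≤ 1 - δ`, then its deletion costs `G` less than passing from
`B₄(n)` to `B₄(n - 1)` costs the benchmark: the ratio `ρ(G) / ρ(B₄(n))` grows by at least `c/n`.
The harmonic series diverges, so a ratio exceeding `1` cannot survive repeated deletion of light
vertices.

If no vertex is light, then `x` is almost constant, the eigenvalue equations
`ρ x_v ^ (α - 1) = (Lagrangian of the link of v at x)` force every degree to be almost
`ρ n ^ (k/α - 1) / (k - 1)!`, and degree stability makes the graph colorable. For its degree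
threshold to be reached one needs `π(𝓕) ≤ 3/8`; this follows from the same descent, with multiples
of `n ^ (k - k/α)` as the benchmark. Colorable graphs lie inside a complete split `4`-graph, whose
spectral radius is explicit and is maximized precisely by the balanced parts.
-/

theorem eventually_forall_le_of_descent {ι : ℕ → Type*} {r : ∀ n, ι n → ℝ} {g : ℕ → ℝ} {b : ℝ}
    (hr : ∀ n, BddAbove (Set.range (r n))) (hg : ∀ n, 0 ≤ g n) (hg' : ¬Summable g)
    (h : ∀ᶠ n in atTop, ∀ i : ι (n + 1), b < r (n + 1) i → ∃ j : ι n, r (n + 1) i + g n ≤ r n j) :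
    ∀ᶠ n in atTop, ∀ i : ι n, r n i ≤ b := by
  obtain ⟨N, hN⟩ := eventually_atTop.mp h
  obtain ⟨C, hC⟩ := hr N
  have descend : ∀ n ≥ N, ∀ i : ι n, b < r n i →
      ∃ j : ι N, r n i + ∑ l ∈ Finset.Ico N n, g l ≤ r N j := by
    intro n hn
    induction n, hn using Nat.le_induction with
    | base => exact fun i _ => ⟨i, by simp⟩
    | succ n hn ih =>
      intro i hi
      obtain ⟨j, hj⟩ := hN n hn i hi
      obtain ⟨j', hj'⟩ := ih j (by linarith [hg n])
      exact ⟨j', by rw [Finset.sum_Ico_succ_top hn]; linarith⟩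
  have hdiv := (not_summable_iff_tendsto_nat_atTop_of_nonneg hg).mp hg'
  filter_upwards [eventually_ge_atTop N,
    hdiv.eventually_gt_atTop (C - b + ∑ l ∈ Finset.range N, g l)] with n hn hsum i
  by_contra! hi
  obtain ⟨j, hj⟩ := descend n hn i hi
  rw [Finset.sum_Ico_eq_sub g hn] at hj
  linarith [hC (Set.mem_range_self j)]

theorem one_sub_rpow_mul_one_add_le {p y : ℝ} (hp : 0 ≤ p) (hy : y ≤ 1) :
    (1 - y) ^ p * (1 + p * y) ≤ 1 := by
  have hpow : (1 - y) ^ p ≤ Real.exp (-(p * y)) := by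
    calc (1 - y) ^ p ≤ Real.exp (-y) ^ p :=
          Real.rpow_le_rpow (by linarith) (Real.one_sub_le_exp_neg y) hp
      _ = Real.exp (-(p * y)) := by rw [← Real.exp_mul]; ring_nf
  calc (1 - y) ^ p * (1 + p * y) ≤ Real.exp (-(p * y)) * Real.exp (p * y) :=
        mul_le_mul_of_nonneg hpow (by linarith [Real.add_one_le_exp (p * y)])
          (Real.rpow_nonneg (by linarith) p) (Real.exp_nonneg _)
    _ = 1 := by rw [← Real.exp_add, neg_add_cancel, Real.exp_zero]

theorem exists_eventually_one_add_mul_rpow_le {p κ δ : ℝ} (hp : 0 ≤ p) (hpκ : p < κ) (hδ : 0 < δ) :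
    ∃ c > 0, ∀ᶠ u in 𝓝[>] 0, ∀ y ∈ Set.Icc 0 ((1 - δ) * u),
      (1 + c * u) * (1 - y) ^ p ≤ (1 - κ * y) * (1 + (κ - p) * u) := by
  set d := κ - p with hd
  have : 0 < d := sub_pos.mpr hpκ
  have hκ : 0 < κ := hp.trans_lt hpκ
  have small (K : ℝ) {b : ℝ} (hb : 0 < b) : ∀ᶠ u in 𝓝[>] (0 : ℝ), K * u < b :=
    (((continuous_const.mul continuous_id).tendsto' (0 : ℝ) 0 (mul_zero K)).eventually_lt_const
      hb).filter_mono nhdsWithin_le_nhds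
  refine ⟨d * δ / 2, by positivity, ?_⟩
  filter_upwards [self_mem_nhdsWithin, small 1 one_pos, small κ one_pos,
    small (κ * p + d ^ 2 + κ * p * d) (b := d * δ / 2) (by positivity)]
    with u (hu : 0 < u) hu1 hκu hquad y ⟨hy0, hy⟩
  have hyu : y ≤ u := by nlinarith
  have hκy : 0 ≤ 1 - κ * y := by nlinarith
  have expansion : 1 + d * δ / 2 * u ≤ (1 - κ * y) * (1 + d * u) * (1 + p * y) := by
    have hyy : κ * p * (y * y) ≤ κ * p * (u * u) := by gcongr
    have hyu' : d ^ 2 * (y * u) ≤ d ^ 2 * (u * u) := by gcongr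
    have hyyu : κ * p * d * (y * y * u) ≤ κ * p * d * (u * u * 1) := by gcongr; linarith
    have hlin : d * y ≤ d * ((1 - δ) * u) := by gcongr
    have hmain := mul_le_mul_of_nonneg_right hquad.le hu.le
    have hκp : κ = d + p := by rw [hd]; ring
    calc 1 + d * δ / 2 * u
        ≤ 1 + d * u - d * y - κ * p * (y * y) - d ^ 2 * (y * u) - κ * p * d * (y * y * u) := by
          linarith
      _ = (1 - κ * y) * (1 + d * u) * (1 + p * y) := by rw [hκp]; ring
  calc (1 + d * δ / 2 * u) * (1 - y) ^ p
      ≤ (1 - κ * y) * (1 + d * u) * (1 + p * y) * (1 - y) ^ p := by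
        gcongr
        exact Real.rpow_nonneg (by linarith) p
    _ = (1 - κ * y) * (1 + d * u) * ((1 - y) ^ p * (1 + p * y)) := by ring
    _ ≤ (1 - κ * y) * (1 + d * u) :=
        mul_le_of_le_one_right (by positivity) (one_sub_rpow_mul_one_add_le hp (by linarith))

theorem exists_eventually_one_add_div_mul_rpow_le {p κ δ : ℝ} (hp : 0 ≤ p) (hpκ : p < κ)
    (hδ : 0 < δ) :
    ∃ c > 0, ∀ᶠ m : ℕ in atTop, ∀ y ∈ Set.Icc 0 ((1 - δ) / (m + 1)),
      (1 + c / (m + 1)) * (1 - y) ^ p ≤ (1 - κ * y) * (1 + (κ - p) / (m + 1)) := by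
  obtain ⟨c, hc, hgain⟩ := exists_eventually_one_add_mul_rpow_le hp hpκ hδ
  have hu : Tendsto (fun m : ℕ => 1 / ((m : ℝ) + 1)) atTop (𝓝[>] 0) :=
    tendsto_nhdsWithin_iff.mpr ⟨tendsto_one_div_add_atTop_nhds_zero_nat,
      Eventually.of_forall fun m => Set.mem_Ioi.mpr Nat.one_div_pos_of_nat⟩
  refine ⟨c, hc, ?_⟩
  simpa only [mul_one_div] using hu.eventually hgain

theorem one_add_mul_le_one_add_rpow {x q : ℝ} (hx : 0 ≤ x) (hq : 0 ≤ q) :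
    1 + q * (2 * x / (x + 2)) ≤ (1 + x) ^ q := by
  calc 1 + q * (2 * x / (x + 2)) ≤ 1 + q * Real.log (1 + x) := by
        gcongr
        exact Real.le_log_one_add_of_nonneg hx
    _ ≤ Real.exp (Real.log (1 + x) * q) := by
        linarith [Real.add_one_le_exp (Real.log (1 + x) * q)]
    _ = (1 + x) ^ q := (Real.rpow_def_of_pos (by linarith) q).symm

theorem eq_of_forall_add_sub_mul_le {α ρ s y p : ℝ}
    (h : ∀ t > 0, ρ + (t - 1) * s ≤ ρ * (1 + (t ^ α - 1) * y) ^ p) : s = ρ * (α * y * p) := by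
  have hmin : IsLocalMin (fun t : ℝ => ρ * (1 + (t ^ α - 1) * y) ^ p - (ρ + (t - 1) * s)) 1 := by
    filter_upwards [lt_mem_nhds (zero_lt_one (α := ℝ))] with t ht
    simpa using h t ht
  have hbase : HasDerivAt (fun t : ℝ => 1 + (t ^ α - 1) * y) (α * y) 1 := by
    simpa using (((Real.hasDerivAt_rpow_const (x := 1) (p := α)
      (Or.inl one_ne_zero)).sub_const 1).mul_const y).const_add 1
  have hlin : HasDerivAt (fun t : ℝ => ρ + (t - 1) * s) s 1 := by
    simpa using (((hasDerivAt_id (1 : ℝ)).sub_const 1).mul_const s).const_add ρ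
  have hpow : HasDerivAt (fun t : ℝ => ρ * (1 + (t ^ α - 1) * y) ^ p) (ρ * (α * y * p)) 1 := by
    simpa using (hbase.rpow_const (p := p) (Or.inl (by simp))).const_mul ρ
  exact (sub_eq_zero.mp (hmin.hasDerivAt_eq_zero (hpow.sub hlin))).symm

namespace KGraph

section Sphere

variable {k : ℕ} {V : Type*}

theorem lagrangian_le_lagrangian_abs (G : KGraph k V) (x : V → ℝ) :
    G.lagrangian x ≤ G.lagrangian (fun v => |x v|) := by
  unfold lagrangian
  simp_rw [← Finset.abs_prod]
  gcongr
  exact le_abs_self _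

theorem lagrangian_nonneg (G : KGraph k V) {x : V → ℝ} (hx : ∀ v, 0 ≤ x v) :
    0 ≤ G.lagrangian x :=
  mul_nonneg (Nat.cast_nonneg _) (Finset.sum_nonneg fun _ _ => Finset.prod_nonneg fun v _ => hx v)

theorem lagrangian_const_mul (G : KGraph k V) (c : ℝ) (x : V → ℝ) :
    G.lagrangian (fun v => c * x v) = c ^ k * G.lagrangian x := by
  unfold lagrangian
  rw [mul_left_comm, Finset.mul_sum (a := c ^ k)]
  congr 1
  refine Finset.sum_congr rfl fun e he => ?_
  rw [Finset.prod_mul_distrib, Finset.prod_const, G.uniform e he]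

theorem lagrangian_zero (hk : k ≠ 0) (G : KGraph k V) : G.lagrangian (fun _ => 0) = 0 := by
  simpa [hk] using G.lagrangian_const_mul 0 (fun _ => 0)

theorem continuous_lagrangian (G : KGraph k V) : Continuous G.lagrangian := by
  unfold lagrangian
  fun_prop

variable [Fintype V] {α : ℝ}

theorem rpow_one_div_eq_one_iff (hα : 0 < α) (x : V → ℝ) :
    (∑ v, |x v| ^ α) ^ (1 / α) = 1 ↔ ∑ v, |x v| ^ α = 1 := by
  have hsum : 0 ≤ ∑ v, |x v| ^ α := Finset.sum_nonneg fun v _ => by positivity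
  rw [← Real.rpow_left_inj hsum zero_le_one (z := 1 / α) (by positivity), Real.one_rpow]

theorem isCompact_sphere (hα : 0 < α) :
    IsCompact {x : V → ℝ | (∑ v, |x v| ^ α) ^ (1 / α) = 1} := by
  simp_rw [rpow_one_div_eq_one_iff hα]
  refine Metric.isCompact_of_isClosed_isBounded ?_ ?_
  · refine isClosed_eq (continuous_finsetSum _ fun v _ => ?_) continuous_const
    exact (continuous_apply v).abs.rpow_const fun _ => Or.inr hα.le
  · refine (Metric.isBounded_closedBall (x := (0 : V → ℝ)) (r := 1)).subset fun x hx => ?_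
    rw [mem_closedBall_zero_iff, pi_norm_le_iff_of_nonneg zero_le_one]
    intro v
    have hv : |x v| ^ α ≤ 1 := by
      rw [← show ∑ v, |x v| ^ α = 1 from hx]
      exact Finset.single_le_sum (f := fun v => |x v| ^ α) (fun v _ => by positivity)
        (Finset.mem_univ v)
    rwa [← Real.one_rpow α, Real.rpow_le_rpow_iff (abs_nonneg _) zero_le_one hα] at hv

theorem lagrangian_le_spectralRadius (hα : 0 < α) (G : KGraph k V) {x : V → ℝ}
    (hx : ∀ v, 0 ≤ x v) (hx1 : ∑ v, x v ^ α = 1) : G.lagrangian x ≤ G.spectralRadius α := by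
  refine le_csSup ((isCompact_sphere hα).image G.continuous_lagrangian).bddAbove
    (Set.mem_image_of_mem _ ?_)
  rw [Set.mem_ofPred_eq, rpow_one_div_eq_one_iff hα]
  simpa only [abs_of_nonneg (hx _)] using hx1

/-- A nonnegative vector of the unit `ℓ_α`-sphere at which the supremum defining the `α`-spectral
radius is attained. -/
structure IsMaximizer (α : ℝ) (G : KGraph k V) (x : V → ℝ) : Prop where
  nonneg : ∀ v, 0 ≤ x v
  sum_rpow : ∑ v, x v ^ α = 1
  lagrangian_eq : G.lagrangian x = G.spectralRadius α

theorem exists_isMaximizer [Nonempty V] (hα : 0 < α) (G : KGraph k V) :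
    ∃ x, G.IsMaximizer α x := by
  classical
  have hne : {x : V → ℝ | (∑ v, |x v| ^ α) ^ (1 / α) = 1}.Nonempty := by
    obtain ⟨v⟩ := ‹Nonempty V›
    refine ⟨Pi.single v 1, (rpow_one_div_eq_one_iff hα _).mpr ?_⟩
    rw [Finset.sum_eq_single v (fun w _ hw => by simp [hw, hα.ne']) (by simp)]
    simp
  obtain ⟨x, hx, hmax⟩ := (isCompact_sphere hα).exists_isMaxOn hne
    G.continuous_lagrangian.continuousOn
  rw [Set.mem_ofPred_eq, rpow_one_div_eq_one_iff hα] at hx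
  refine ⟨fun v => |x v|, fun v => abs_nonneg _, hx, le_antisymm
    (G.lagrangian_le_spectralRadius hα (fun v => abs_nonneg _) hx) (csSup_le (hne.image _) ?_)⟩
  rintro _ ⟨y, hy, rfl⟩
  exact (hmax hy).trans (G.lagrangian_le_lagrangian_abs x)

theorem spectralRadius_le [Nonempty V] (hα : 0 < α) (G : KGraph k V) {C : ℝ}
    (h : ∀ x : V → ℝ, (∀ v, 0 ≤ x v) → ∑ v, x v ^ α = 1 → G.lagrangian x ≤ C) :
    G.spectralRadius α ≤ C := by
  obtain ⟨x, hx⟩ := G.exists_isMaximizer hα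
  exact hx.lagrangian_eq ▸ h x hx.nonneg hx.sum_rpow

theorem spectralRadius_nonneg [Nonempty V] (hα : 0 < α) (G : KGraph k V) :
    0 ≤ G.spectralRadius α := by
  obtain ⟨x, hx⟩ := G.exists_isMaximizer hα
  exact hx.lagrangian_eq ▸ G.lagrangian_nonneg hx.nonneg

theorem lagrangian_le_spectralRadius_mul_rpow [Nonempty V] (hα : 0 < α) (hk : k ≠ 0)
    (G : KGraph k V) {x : V → ℝ} (hx : ∀ v, 0 ≤ x v) :
    G.lagrangian x ≤ G.spectralRadius α * (∑ v, x v ^ α) ^ (k / α : ℝ) := by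
  set s := ∑ v, x v ^ α with hs
  have hxα : ∀ v, 0 ≤ x v ^ α := fun v => Real.rpow_nonneg (hx v) _
  rcases (Finset.sum_nonneg fun v _ => hxα v : 0 ≤ s).eq_or_lt with hs0 | hs0
  · have hx0 : x = fun _ => 0 := funext fun v => (Real.rpow_eq_zero (hx v) hα.ne').mp <|
      (Finset.sum_eq_zero_iff_of_nonneg fun v _ => hxα v).mp hs0.symm v (Finset.mem_univ v)
    rw [hx0, G.lagrangian_zero hk]
    exact mul_nonneg (G.spectralRadius_nonneg hα) (Real.rpow_nonneg (hs0.le) _)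
  · set c := s ^ (1 / α) with hc
    have hc0 : 0 < c := Real.rpow_pos_of_pos hs0 _
    have hcα : c ^ α = s := by
      rw [hc, ← Real.rpow_mul hs0.le, one_div_mul_cancel hα.ne', Real.rpow_one]
    have hck : c ^ k = s ^ (k / α : ℝ) := by
      rw [hc, ← Real.rpow_mul_natCast hs0.le, one_div_mul_eq_div]
    have hunit : ∑ v, (c⁻¹ * x v) ^ α = 1 := by
      simp_rw [Real.mul_rpow (inv_nonneg.mpr hc0.le) (hx _), Real.inv_rpow hc0.le, hcα,
        ← Finset.mul_sum, ← hs]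
      exact inv_mul_cancel₀ hs0.ne'
    have hle := G.lagrangian_le_spectralRadius hα
      (fun v => mul_nonneg (inv_nonneg.mpr hc0.le) (hx v)) hunit
    rwa [lagrangian_const_mul, inv_pow, inv_mul_le_iff₀ (by positivity), hck, mul_comm] at hle

end Sphere

section Comap

variable {k : ℕ} {V W : Type*}

/-- The pullback of a `k`-graph along an injection `f`. When `f` is an inclusion, this is the
induced sub-hypergraph. -/
noncomputable def comap (f : W ↪ V) (G : KGraph k V) : KGraph k W where
  edges := G.edges.preimage (Finset.map f) (Finset.map_injective f).injOn
  uniform e he := by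
    rw [← G.uniform _ (Finset.mem_preimage.mp he), Finset.card_map]

theorem mem_edges_comap {f : W ↪ V} {G : KGraph k V} {e : Finset W} :
    e ∈ (G.comap f).edges ↔ e.map f ∈ G.edges := by
  rw [comap, Finset.mem_preimage]

theorem Free.comap {G : KGraph k V} {𝓕 : KFamily k} (hG : G.Free 𝓕) (f : W ↪ V) :
    (G.comap f).Free 𝓕 := by
  rintro F hF ⟨g, hg⟩
  refine hG F hF ⟨g.trans f, fun e he => ?_⟩
  rw [← Finset.map_map]
  exact mem_edges_comap.mp (hg e he)

theorem mem_range_finset_map {f : W ↪ V} {e : Finset V} :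
    e ∈ Set.range (Finset.map f) ↔ ∀ v ∈ e, v ∈ Set.range f := by
  classical
  constructor
  · rintro ⟨e', rfl⟩
    exact fun v hv => Finset.coe_map_subset_range f e' hv
  · intro he
    obtain ⟨e', -, rfl⟩ :=
      Finset.subset_set_image_iff.mp (Set.image_univ (f := f) ▸ fun v hv => he v hv)
    exact ⟨e', Finset.map_eq_image f e'⟩

theorem lagrangian_comap (f : W ↪ V) (G : KGraph k V) {x : V → ℝ}
    (hx : ∀ v ∉ Set.range f, x v = 0) : (G.comap f).lagrangian (x ∘ f) = G.lagrangian x := by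
  unfold lagrangian KGraph.comap
  simp only [Function.comp_apply, ← Finset.prod_map]
  rw [Finset.sum_preimage _ _ _ (fun e => ∏ v ∈ e, x v)]
  intro e _ hrange
  rw [mem_range_finset_map] at hrange
  push Not at hrange
  obtain ⟨v, hve, hv⟩ := hrange
  exact Finset.prod_eq_zero hve (hx v hv)

theorem Iso.comap_eq {G : KGraph k V} {H : KGraph k W} (h : G.Iso H) :
    ∃ f : V ≃ W, G = H.comap f.toEmbedding := by
  obtain ⟨f, hf⟩ := h
  exact ⟨f, KGraph.ext (Finset.ext fun e => (hf e).trans mem_edges_comap.symm)⟩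

theorem Iso.spectralRadius_eq [Fintype V] [Fintype W] {G : KGraph k V} {H : KGraph k W}
    (h : G.Iso H) (α : ℝ) : G.spectralRadius α = H.spectralRadius α := by
  obtain ⟨f, rfl⟩ := h.comap_eq
  unfold spectralRadius
  have hsphere : {x : V → ℝ | (∑ v, |x v| ^ α) ^ (1 / α) = 1} =
      (· ∘ f) '' {x : W → ℝ | (∑ v, |x v| ^ α) ^ (1 / α) = 1} := by
    rw [Set.image_eq_preimage_of_inverse (g := (· ∘ f.symm)) (fun x => by ext; simp)
      (fun x => by ext; simp)]
    ext x
    simp only [Set.mem_preimage, Set.mem_ofPred_eq, Function.comp_apply,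
      Equiv.sum_comp f.symm (fun v => |x v| ^ α)]
  rw [hsphere, Set.image_image]
  exact congrArg sSup (Set.image_congr' fun x => lagrangian_comap _ _ (by simp))

end Comap

end KGraph

namespace KGraph

section Link

variable {k : ℕ} {V : Type*} [DecidableEq V]

/-- The link of `v`: the `(k - 1)`-graph of the sets that form an edge together with `v`. -/
def link (G : KGraph k V) (v : V) : KGraph (k - 1) V where
  edges := {e ∈ G.edges | v ∈ e}.image (Finset.erase · v)
  uniform e' he' := by
    obtain ⟨e, he, rfl⟩ := Finset.mem_image.mp he'
    obtain ⟨heG, hv⟩ := Finset.mem_filter.mp he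
    rw [Finset.card_erase_of_mem hv, G.uniform e heG]

theorem injOn_erase (G : KGraph k V) (v : V) :
    Set.InjOn (Finset.erase · v) ({e ∈ G.edges | v ∈ e} : Finset (Finset V)) :=
  (Finset.erase_injOn' v).mono fun _ he => (Finset.mem_filter.mp he).2

theorem card_edges_link (G : KGraph k V) (v : V) : (G.link v).edges.card = G.degree v :=
  Finset.card_image_of_injOn (G.injOn_erase v)

theorem lagrangian_link (G : KGraph k V) (v : V) (x : V → ℝ) :
    (G.link v).lagrangian x =
      (k - 1).factorial * ∑ e ∈ G.edges with v ∈ e, ∏ u ∈ e.erase v, x u :=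
  congrArg _ (Finset.sum_image (G.injOn_erase v))

theorem lagrangian_update (hk : k ≠ 0) (G : KGraph k V) (x : V → ℝ) (v : V) (s : ℝ) :
    G.lagrangian (Function.update x v s) =
      G.lagrangian x + (s - x v) * (k * (G.link v).lagrangian x) := by
  have split_at : ∀ y : V → ℝ, (∀ u ≠ v, y u = x u) → G.lagrangian y =
      y v * (k * (G.link v).lagrangian x) +
        k.factorial * ∑ e ∈ G.edges with v ∉ e, ∏ u ∈ e, x u := by
    intro y hy
    have through : ∑ e ∈ G.edges with v ∈ e, ∏ u ∈ e, y u =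
        y v * ∑ e ∈ G.edges with v ∈ e, ∏ u ∈ e.erase v, x u := by
      rw [Finset.mul_sum]
      refine Finset.sum_congr rfl fun e he => ?_
      rw [← Finset.mul_prod_erase e y (Finset.mem_filter.mp he).2]
      exact congrArg _ (Finset.prod_congr rfl fun u hu => hy u (Finset.ne_of_mem_erase hu))
    have avoiding : ∑ e ∈ G.edges with v ∉ e, ∏ u ∈ e, y u =
        ∑ e ∈ G.edges with v ∉ e, ∏ u ∈ e, x u :=
      Finset.sum_congr rfl fun e he => Finset.prod_congr rfl fun u hu =>
        hy u (ne_of_mem_of_not_mem hu (Finset.mem_filter.mp he).2)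
    rw [lagrangian, ← Finset.sum_filter_add_sum_filter_not G.edges (fun e => v ∈ e), through,
      avoiding, lagrangian_link, ← Nat.mul_factorial_pred hk]
    push_cast
    ring
  rw [split_at _ fun u hu => Function.update_of_ne hu _ _, split_at x fun _ _ => rfl,
    Function.update_self]
  ring

variable [Fintype V] {α : ℝ} {G : KGraph k V} {x : V → ℝ}

theorem sum_update_rpow (x : V → ℝ) (v : V) (s α : ℝ) :
    ∑ u, Function.update x v s u ^ α = ∑ u, x u ^ α + (s ^ α - x v ^ α) := by
  rw [← Finset.add_sum_erase _ _ (Finset.mem_univ v),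
    ← Finset.add_sum_erase _ (fun u => x u ^ α) (Finset.mem_univ v), Function.update_self,
    Finset.sum_congr rfl fun u hu => by rw [Function.update_of_ne (Finset.ne_of_mem_erase hu)]]
  ring

namespace IsMaximizer

-- Scaling the coordinate of `v` by `t` preserves the inequality
-- `lagrangian_le_spectralRadius_mul_rpow`, which is an equality at `t = 1`.
theorem mul_lagrangian_link (hα : 0 < α) (hk : k ≠ 0) (hx : G.IsMaximizer α x) (v : V) :
    x v * (G.link v).lagrangian x = G.spectralRadius α * x v ^ α := by
  have : Nonempty V := ⟨v⟩
  have scaled : ∀ t > 0, G.spectralRadius α + (t - 1) * (k * (x v * (G.link v).lagrangian x)) ≤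
      G.spectralRadius α * (1 + (t ^ α - 1) * x v ^ α) ^ (k / α : ℝ) := by
    intro t ht
    have hnonneg : ∀ u, 0 ≤ Function.update x v (t * x v) u :=
      (Function.forall_update_iff x fun _ r => 0 ≤ r).mpr
        ⟨mul_nonneg ht.le (hx.nonneg v), fun u _ => hx.nonneg u⟩
    have hle := G.lagrangian_le_spectralRadius_mul_rpow hα hk hnonneg
    rw [lagrangian_update hk, sum_update_rpow, hx.sum_rpow, hx.lagrangian_eq,
      Real.mul_rpow ht.le (hx.nonneg v)] at hle
    convert hle using 1
    · ring
    · ring_nf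
  have hcrit := eq_of_forall_add_sub_mul_le scaled
  have hk' : (k : ℝ) ≠ 0 := Nat.cast_ne_zero.mpr hk
  field_simp at hcrit
  exact hcrit

end IsMaximizer

end Link

theorem IsMaximizer.spectralRadius_mul_le_comap {k : ℕ} {V W : Type*} [Fintype V] [Fintype W]
    [Nonempty W] {α : ℝ} {G : KGraph k V} {x : V → ℝ} (hα : 0 < α) (hk : k ≠ 0)
    (hx : G.IsMaximizer α x) {v : V} {f : W ↪ V} (hf : Set.range f = {v}ᶜ) :
    G.spectralRadius α * (1 - k * x v ^ α) ≤
      (G.comap f).spectralRadius α * (1 - x v ^ α) ^ (k / α : ℝ) := by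
  classical
  have hfv : ∀ w, f w ≠ v := fun w => by
    simpa [hf] using Set.mem_range_self (f := f) w
  have hcomp : Function.update x v 0 ∘ f = x ∘ f :=
    funext fun w => Function.update_of_ne (hfv w) _ _
  have hsum : ∑ w, (x ∘ f) w ^ α = 1 - x v ^ α := by
    have hmap : Finset.univ.map f = Finset.univ.erase v := by
      ext u
      simpa using Set.ext_iff.mp hf u
    rw [← hx.sum_rpow, ← Finset.sum_erase_eq_sub (Finset.mem_univ v), ← hmap, Finset.sum_map]
    rfl
  calc G.spectralRadius α * (1 - k * x v ^ α)
      = G.lagrangian (Function.update x v 0) := by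
        rw [lagrangian_update hk, hx.lagrangian_eq]
        linear_combination (k : ℝ) * hx.mul_lagrangian_link hα hk v
    _ = (G.comap f).lagrangian (x ∘ f) := by
        rw [← lagrangian_comap f, hcomp]
        intro u hu
        rw [hf, Set.notMem_compl_iff, Set.mem_singleton_iff] at hu
        rw [hu, Function.update_self]
    _ ≤ (G.comap f).spectralRadius α * (1 - x v ^ α) ^ (k / α : ℝ) :=
        hsum ▸ (G.comap f).lagrangian_le_spectralRadius_mul_rpow hα hk fun w => hx.nonneg (f w)

section Degree

variable {k : ℕ} {V : Type*} [Fintype V]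

-- Each `k`-set is the image of an injection `Fin k → V`, and `∑ f, ∏ j, M (f j) = (∑ v, M v) ^ k`.
theorem sum_prod_sub_one_le (G : KGraph k V) {M : V → ℝ} (hM : ∀ v, 1 ≤ M v) :
    ∑ e ∈ G.edges, (∏ v ∈ e, M v - 1) ≤ (∑ v, M v) ^ k - (Fintype.card V : ℝ) ^ k := by
  classical
  have enum : ∀ e : G.edges, ∃ f : Fin k → V, ∏ j, M (f j) = ∏ v ∈ e.1, M v ∧
      Set.range f = e.1 := by
    rintro ⟨e, he⟩
    let σ := Finset.equivFinOfCardEq (G.uniform e he)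
    refine ⟨fun j => σ.symm j, ?_, ?_⟩
    · rw [Equiv.prod_comp σ.symm fun u => M u, Finset.prod_coe_sort]
    · rw [← Function.comp_def, σ.symm.surjective.range_comp, Subtype.range_coe]
  choose f hprod hrange using enum
  have hinj : Function.Injective f := fun e e' h => by
    rw [← Subtype.coe_inj, ← Finset.coe_inj, ← hrange, ← hrange, h]
  calc ∑ e ∈ G.edges, (∏ v ∈ e, M v - 1) = ∑ e, (∏ j, M (f e j) - 1) := by
        simp_rw [hprod]
        exact (Finset.sum_coe_sort G.edges _).symm
    _ = ∑ g ∈ Finset.univ.map ⟨f, hinj⟩, (∏ j, M (g j) - 1) := by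
        rw [Finset.sum_map]
        rfl
    _ ≤ ∑ g : Fin k → V, (∏ j, M (g j) - 1) :=
        Finset.sum_le_univ_sum_of_nonneg fun g => sub_nonneg.mpr <|
          Finset.one_le_prod fun j _ => hM (g j)
    _ = (∑ v, M v) ^ k - (Fintype.card V : ℝ) ^ k := by
        simp [Finset.sum_sub_distrib, Fintype.sum_pow]

theorem lagrangian_le_factorial_mul (G : KGraph k V) {w M : V → ℝ} (hw : ∀ v, 0 ≤ w v)
    (hwM : ∀ v, w v ≤ M v) (hM : ∀ v, 1 ≤ M v) :
    G.lagrangian w ≤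
      k.factorial * (G.edges.card + ((∑ v, M v) ^ k - (Fintype.card V : ℝ) ^ k)) := by
  unfold lagrangian
  gcongr
  calc ∑ e ∈ G.edges, ∏ v ∈ e, w v ≤ ∑ e ∈ G.edges, ∏ v ∈ e, M v := by
        gcongr with e _ v
        · exact fun v _ => hw v
        · exact hwM v
    _ = G.edges.card + ∑ e ∈ G.edges, (∏ v ∈ e, M v - 1) := by
        simp [Finset.sum_sub_distrib]
    _ ≤ G.edges.card + ((∑ v, M v) ^ k - (Fintype.card V : ℝ) ^ k) := by
        gcongr
        exact G.sum_prod_sub_one_le hM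

end Degree

end KGraph

theorem mul_le_rpow_of_le_rpow {w δ α : ℝ} (hw : 0 ≤ w) (hα : 1 ≤ α) (hδ : 0 ≤ δ)
    (h : 1 - δ ≤ w ^ α) : (1 - δ) * w ≤ w ^ α := by
  rcases le_total w 1 with hw1 | hw1
  · calc (1 - δ) * w ≤ w ^ α * w := by gcongr
      _ ≤ w ^ α := mul_le_of_le_one_right (Real.rpow_nonneg hw α) hw1
  · calc (1 - δ) * w ≤ w := mul_le_of_le_one_left hw (by linarith)
      _ ≤ w ^ α := Real.self_le_rpow_of_one_le hw1 hα

theorem max_one_le_rpow_add {w δ α : ℝ} (hα : 1 ≤ α) (hδ : 0 ≤ δ) (h : 1 - δ ≤ w ^ α) :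
    max w 1 ≤ w ^ α + δ := by
  refine max_le ?_ (by linarith)
  rcases le_total w 1 with hw1 | hw1
  · linarith
  · linarith [Real.self_le_rpow_of_one_le hw1 hα]

namespace KGraph

section NearlyBalanced

variable {k : ℕ} {V : Type*} [Fintype V] [DecidableEq V] {α δ μ : ℝ} {G : KGraph k V} {x : V → ℝ}

namespace IsMaximizer

theorem le_lagrangian_link (hα : 1 < α) (hk : k ≠ 0) (hx : G.IsMaximizer α x)
    (hδ0 : 0 ≤ δ) (hδ1 : δ < 1)
    (hμ : μ * (Fintype.card V : ℝ) ^ (k - k / α : ℝ) ≤ G.spectralRadius α) {v : V}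
    (hv : 1 - δ ≤ Fintype.card V * x v ^ α) :
    μ * (1 - δ) * (Fintype.card V : ℝ) ^ (k - 1) ≤
      (G.link v).lagrangian fun u => (Fintype.card V : ℝ) ^ (1 / α) * x u := by
  have : Nonempty V := ⟨v⟩
  have hα0 : 0 < α := one_pos.trans hα
  set n : ℝ := (Fintype.card V : ℝ)
  have hn : 0 < n := Nat.cast_pos.mpr Fintype.card_pos
  set c := n ^ (1 / α) with hc
  have hc0 : 0 < c := Real.rpow_pos_of_pos hn _
  have hw0 : 0 ≤ c * x v := mul_nonneg hc0.le (hx.nonneg v)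
  have hwα : (c * x v) ^ α = n * x v ^ α := by
    rw [Real.mul_rpow hc0.le (hx.nonneg v), hc, ← Real.rpow_mul hn.le,
      one_div_mul_cancel hα0.ne', Real.rpow_one]
  have hwpos : 0 < c * x v := by
    refine hw0.lt_of_ne fun h0 => ?_
    rw [← hwα, ← h0, Real.zero_rpow hα0.ne'] at hv
    linarith
  have hμ' : μ * n ^ (k - 1) ≤ c ^ k * G.spectralRadius α / n := by
    have hexp : c ^ k * n ^ (k - k / α : ℝ) = n ^ (k - 1) * n := by
      rw [pow_sub_one_mul hk, hc, ← Real.rpow_mul_natCast hn.le, ← Real.rpow_add hn,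
        ← Real.rpow_natCast n k]
      ring_nf
    calc μ * n ^ (k - 1) = c ^ k * (μ * n ^ (k - k / α : ℝ)) / n := by
          rw [mul_left_comm, hexp]
          field_simp
      _ ≤ c ^ k * G.spectralRadius α / n := by gcongr
  rw [lagrangian_const_mul]
  refine le_of_mul_le_mul_left ?_ hwpos
  calc c * x v * (μ * (1 - δ) * n ^ (k - 1))
      = (μ * n ^ (k - 1)) * ((1 - δ) * (c * x v)) := by ring
    _ ≤ (c ^ k * G.spectralRadius α / n) * ((1 - δ) * (c * x v)) :=
        mul_le_mul_of_nonneg_right hμ' (mul_nonneg (by linarith) hw0)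
    _ ≤ (c ^ k * G.spectralRadius α / n) * (c * x v) ^ α := by
        gcongr
        · exact div_nonneg (mul_nonneg (by positivity) (G.spectralRadius_nonneg hα0)) hn.le
        · exact mul_le_rpow_of_le_rpow hw0 hα.le hδ0 (hwα ▸ hv)
    _ = c ^ k * (G.spectralRadius α * x v ^ α) := by
        rw [hwα]
        field_simp
    _ = c * x v * (c ^ (k - 1) * (G.link v).lagrangian x) := by
        rw [← hx.mul_lagrangian_link hα0 hk, ← mul_pow_sub_one hk c]
        ring

theorem le_degree (hα : 1 < α) (hk : k ≠ 0) (hx : G.IsMaximizer α x) (hδ0 : 0 ≤ δ) (hδ1 : δ < 1)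
    (hμ : μ * (Fintype.card V : ℝ) ^ (k - k / α : ℝ) ≤ G.spectralRadius α)
    (hbal : ∀ v, 1 - δ ≤ Fintype.card V * x v ^ α) (v : V) :
    (μ * (1 - δ) / (k - 1).factorial - ((1 + δ) ^ (k - 1) - 1)) *
      (Fintype.card V : ℝ) ^ (k - 1) ≤ G.degree v := by
  set n : ℝ := (Fintype.card V : ℝ) with hn
  set w : V → ℝ := fun u => n ^ (1 / α) * x u
  have hw0 : ∀ u, 0 ≤ w u := fun u =>
    mul_nonneg (Real.rpow_nonneg (Nat.cast_nonneg _) _) (hx.nonneg u)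
  have hwα : ∀ u, w u ^ α = n * x u ^ α := fun u => by
    rw [Real.mul_rpow (Real.rpow_nonneg (Nat.cast_nonneg _) _) (hx.nonneg u),
      ← Real.rpow_mul (Nat.cast_nonneg _), one_div_mul_cancel (one_pos.trans hα).ne', Real.rpow_one]
  have hsum : ∑ u, max (w u) 1 ≤ (1 + δ) * n := by
    calc ∑ u, max (w u) 1 ≤ ∑ u, (n * x u ^ α + δ) := by
          gcongr with u
          rw [← hwα u]
          exact max_one_le_rpow_add hα.le hδ0 (hwα u ▸ hbal u)
      _ = (1 + δ) * n := by
          rw [Finset.sum_add_distrib, ← Finset.mul_sum, hx.sum_rpow, Finset.sum_const,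
            Finset.card_univ, nsmul_eq_mul, hn]
          ring
  have hupper : (G.link v).lagrangian w ≤
      (k - 1).factorial * (G.degree v + ((1 + δ) ^ (k - 1) - 1) * n ^ (k - 1)) := by
    refine ((G.link v).lagrangian_le_factorial_mul hw0 (fun u => le_max_left _ 1)
      fun u => le_max_right _ _).trans ?_
    rw [card_edges_link, sub_one_mul, ← mul_pow]
    gcongr
  have hlower := hx.le_lagrangian_link hα hk hδ0 hδ1 hμ (hbal v)
  have hfac : (0 : ℝ) < (k - 1).factorial := by positivity
  rw [sub_mul, div_mul_eq_mul_div, sub_le_iff_le_add, div_le_iff₀' hfac]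
  exact hlower.trans hupper

end IsMaximizer

end NearlyBalanced

section Uniform

theorem factorial_mul_card_edges_le {k : ℕ} {V : Type*} [Fintype V] [Nonempty V] {α : ℝ}
    (hα : 0 < α) (hk : k ≠ 0) (G : KGraph k V) :
    k.factorial * G.edges.card ≤ G.spectralRadius α * (Fintype.card V : ℝ) ^ (k / α : ℝ) := by
  have hone : G.lagrangian (fun _ => 1) = k.factorial * G.edges.card := by
    simp [lagrangian]
  simpa [hone] using
    G.lagrangian_le_spectralRadius_mul_rpow hα hk (x := fun _ => 1) fun _ => zero_le_one

end Uniform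

end KGraph

section TuranDensity

variable {k : ℕ} (𝓕 : KFamily k)

instance KGraph.instFinite {V : Type*} [Finite V] : Finite (KGraph k V) :=
  Finite.of_injective KGraph.edges fun _ _ => KGraph.ext

theorem bddAbove_card_edges_free (n : ℕ) :
    BddAbove {m : ℕ | ∃ H : KGraph k (Fin n), H.Free 𝓕 ∧ H.edges.card = m} :=
  ((Set.finite_range fun H : KGraph k (Fin n) => H.edges.card).subset
    (by rintro m ⟨H, -, rfl⟩; exact ⟨H, rfl⟩)).bddAbove

variable {𝓕}

theorem KGraph.Free.card_edges_le_turanNumber {n : ℕ} {G : KGraph k (Fin n)} (hG : G.Free 𝓕) :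
    G.edges.card ≤ turanNumber n 𝓕 :=
  le_csSup (bddAbove_card_edges_free 𝓕 n) ⟨G, hG, rfl⟩

theorem turanNumber_le {n C : ℕ} (h : ∀ G : KGraph k (Fin n), G.Free 𝓕 → G.edges.card ≤ C) :
    turanNumber n 𝓕 ≤ C :=
  csSup_le' (by rintro m ⟨H, hH, rfl⟩; exact h H hH)

theorem KGraph.card_edges_comap_succAboveEmb {n : ℕ} (G : KGraph k (Fin (n + 1)))
    (v : Fin (n + 1)) : (G.comap v.succAboveEmb).edges.card = {e ∈ G.edges | v ∉ e}.card := by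
  classical
  rw [comap, Finset.card_preimage]
  congr 1
  refine Finset.filter_congr fun e _ => ?_
  rw [mem_range_finset_map]
  simp only [Fin.coe_succAboveEmb, Fin.range_succAbove, Set.mem_compl_iff, Set.mem_singleton_iff]
  exact ⟨fun h hv => h v hv rfl, fun hv u hu huv => hv (huv ▸ hu)⟩

theorem KGraph.sum_card_edges_comap_succAboveEmb {n : ℕ} (G : KGraph k (Fin (n + 1))) :
    ∑ v : Fin (n + 1), (G.comap v.succAboveEmb).edges.card = (n + 1 - k) * G.edges.card := by
  simp_rw [card_edges_comap_succAboveEmb]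
  rw [mul_comm]
  refine (Finset.sum_card_bipartiteAbove_eq_sum_card_bipartiteBelow fun v e => v ∉ e).trans ?_
  refine Finset.sum_const_nat fun e he => ?_
  have hcompl : Finset.univ.bipartiteBelow (fun v e => v ∉ e) e = eᶜ := by
    ext v
    simp [Finset.mem_bipartiteBelow]
  rw [hcompl, Finset.card_compl, Fintype.card_fin, G.uniform e he]

theorem sub_mul_turanNumber_succ_le (n : ℕ) :
    (n + 1 - k) * turanNumber (n + 1) 𝓕 ≤ (n + 1) * turanNumber n 𝓕 := by
  rcases Set.eq_empty_or_nonempty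
    {m : ℕ | ∃ H : KGraph k (Fin (n + 1)), H.Free 𝓕 ∧ H.edges.card = m} with hempty | hne
  · simp [turanNumber, hempty]
  obtain ⟨G, hG, hcard⟩ := Nat.sSup_mem hne (bddAbove_card_edges_free 𝓕 (n + 1))
  calc (n + 1 - k) * turanNumber (n + 1) 𝓕
      = ∑ v : Fin (n + 1), (G.comap v.succAboveEmb).edges.card := by
        rw [G.sum_card_edges_comap_succAboveEmb, hcard, turanNumber]
    _ ≤ ∑ _v : Fin (n + 1), turanNumber n 𝓕 := by
        gcongr with v
        exact (hG.comap _).card_edges_le_turanNumber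
    _ = (n + 1) * turanNumber n 𝓕 := by simp

theorem antitone_turanNumber_div_choose :
    Antitone fun m => (turanNumber (m + k) 𝓕 : ℝ) / (m + k).choose k := by
  refine antitone_nat_of_succ_le fun m => ?_
  have hchoose := Nat.choose_mul_succ_eq (m + k) k
  have hturan := sub_mul_turanNumber_succ_le (𝓕 := 𝓕) (m + k)
  rw [show m + k + 1 - k = m + 1 by omega] at hchoose hturan
  have hpos : ∀ n ≥ k, (0 : ℝ) < n.choose k := fun n hn => Nat.cast_pos.mpr (Nat.choose_pos hn)
  rw [Nat.add_right_comm m 1 k, div_le_div_iff₀ (hpos _ (by omega)) (hpos _ (by omega))]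
  norm_cast
  refine Nat.le_of_mul_le_mul_left (c := m + k + 1) ?_ (Nat.succ_pos _)
  calc (m + k + 1) * (turanNumber (m + k + 1) 𝓕 * (m + k).choose k)
      = (m + k + 1).choose k * ((m + 1) * turanNumber (m + k + 1) 𝓕) := by
        linear_combination turanNumber (m + k + 1) 𝓕 * hchoose
    _ ≤ (m + k + 1).choose k * ((m + k + 1) * turanNumber (m + k) 𝓕) := by gcongr
    _ = (m + k + 1) * (turanNumber (m + k) 𝓕 * (m + k + 1).choose k) := by ring

theorem tendsto_turanNumber_div_choose :
    Tendsto (fun n => (turanNumber n 𝓕 : ℝ) / n.choose k) atTop (𝓝 (turanDensity 𝓕)) := by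
  have hbdd : BddBelow (Set.range fun m => (turanNumber (m + k) 𝓕 : ℝ) / (m + k).choose k) :=
    ⟨0, by rintro _ ⟨m, rfl⟩; positivity⟩
  exact tendsto_nhds_limUnder
    ⟨_, (tendsto_add_atTop_iff_nat k).mp (tendsto_atTop_ciInf antitone_turanNumber_div_choose hbdd)⟩

theorem tendsto_factorial_mul_turanNumber_div_pow :
    Tendsto (fun n => k.factorial * (turanNumber n 𝓕 : ℝ) / (n : ℝ) ^ k) atTop
      (𝓝 (turanDensity 𝓕)) := by
  have hchoose : Tendsto (fun n : ℕ => (n.choose k : ℝ) / ((n : ℝ) ^ k / k.factorial)) atTop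
      (𝓝 1) := by
    refine (Asymptotics.isEquivalent_iff_tendsto_one ?_).mp (isEquivalent_choose k)
    filter_upwards [eventually_gt_atTop 0] with n hn
    positivity
  have hprod := tendsto_turanNumber_div_choose (𝓕 := 𝓕).mul hchoose
  rw [mul_one] at hprod
  refine hprod.congr' ?_
  filter_upwards [eventually_ge_atTop k] with n hn
  have : (n.choose k : ℝ) ≠ 0 := Nat.cast_ne_zero.mpr (Nat.choose_pos hn).ne'
  field_simp

end TuranDensity

namespace KGraph

theorem exists_gain_of_light_vertex {k : ℕ} (hk : k ≠ 0) {α δ : ℝ} (hα : 1 < α) (hδ : 0 < δ) :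
    ∃ c > 0, ∀ᶠ m : ℕ in atTop, ∀ (G : KGraph k (Fin (m + 1))) (x : Fin (m + 1) → ℝ)
      (v : Fin (m + 1)), G.IsMaximizer α x → (m + 1) * x v ^ α ≤ 1 - δ →
      G.spectralRadius α * (1 + c / (m + 1)) ≤
        (G.comap v.succAboveEmb).spectralRadius α * (1 + (k - k / α) / (m + 1)) := by
  have hk' : (0 : ℝ) < k := Nat.cast_pos.mpr (Nat.pos_of_ne_zero hk)
  have hα0 : 0 < α := one_pos.trans hα
  obtain ⟨c, hc, hgain⟩ := exists_eventually_one_add_div_mul_rpow_le (p := k / α) (κ := k)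
    (by positivity) (div_lt_self hk' hα) hδ
  refine ⟨c, hc, ?_⟩
  filter_upwards [hgain, eventually_gt_atTop 0] with m hm hm0 G x v hx hv
  have : Nonempty (Fin m) := ⟨⟨0, hm0⟩⟩
  set y := x v ^ α
  have hy0 : 0 ≤ y := Real.rpow_nonneg (hx.nonneg v) α
  have hyu : y ≤ (1 - δ) / (m + 1) := (le_div_iff₀' (by positivity)).mpr hv
  have hy1 : y < 1 := by
    have : (0 : ℝ) ≤ m := m.cast_nonneg
    nlinarith
  have hpow : 0 < (1 - y) ^ (k / α : ℝ) := Real.rpow_pos_of_pos (by linarith) _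
  have hρ := G.spectralRadius_nonneg hα0
  have hdel := hx.spectralRadius_mul_le_comap hα0 hk (f := v.succAboveEmb) (v := v)
    (by simp [Fin.range_succAbove])
  have hgrow : 0 ≤ 1 + (k - k / α) / ((m : ℝ) + 1) := by
    have : k / α ≤ k := div_le_self hk'.le hα.le
    have : 0 ≤ (k - k / α) / ((m : ℝ) + 1) := div_nonneg (by linarith) (by positivity)
    linarith
  refine le_of_mul_le_mul_right ?_ hpow
  calc G.spectralRadius α * (1 + c / (m + 1)) * (1 - y) ^ (k / α : ℝ)
      = G.spectralRadius α * ((1 + c / (m + 1)) * (1 - y) ^ (k / α : ℝ)) := mul_assoc _ _ _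
    _ ≤ G.spectralRadius α * ((1 - k * y) * (1 + (k - k / α) / (m + 1))) :=
        mul_le_mul_of_nonneg_left (hm y ⟨hy0, hyu⟩) hρ
    _ = G.spectralRadius α * (1 - k * y) * (1 + (k - k / α) / (m + 1)) := by ring
    _ ≤ (G.comap v.succAboveEmb).spectralRadius α * (1 - y) ^ (k / α : ℝ) *
          (1 + (k - k / α) / (m + 1)) := by gcongr
    _ = _ := by ring

end KGraph

/-- An eventual upper bound `b` for the `α`-spectral radii of the members of `ℌ` whose growth is at
least that of `n ^ (k - k / α)`, the order of magnitude of the spectral radius of a dense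
`k`-graph. -/
structure IsSpectralMajorant {k : ℕ} (α : ℝ) (ℌ : KFamily k) (b : ℕ → ℝ) : Prop where
  pos : ∀ᶠ n in atTop, 0 < b n
  growth : ∀ᶠ m : ℕ in atTop, b m * (1 + (k - k / α) / (m + 1)) ≤ b (m + 1)
  spectralRadius_le : ∀ᶠ n in atTop, ∀ H : KGraph k (Fin n), ⟨n, H⟩ ∈ ℌ → H.spectralRadius α ≤ b n

theorem IsSpectralMajorant.const_mul_rpow {k : ℕ} {α μ : ℝ} (hα : 1 < α) (hμ : 0 < μ)
    {ℌ : KFamily k} (hℌ : ∀ᶠ n : ℕ in atTop, ∀ H : KGraph k (Fin n), ⟨n, H⟩ ∈ ℌ →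
      H.spectralRadius α ≤ μ * (n : ℝ) ^ (k - k / α : ℝ)) :
    IsSpectralMajorant α ℌ fun n => μ * (n : ℝ) ^ (k - k / α : ℝ) where
  pos := by
    filter_upwards [eventually_gt_atTop 0] with n hn
    positivity
  growth := by
    have hq : 0 ≤ (k - k / α : ℝ) := sub_nonneg.mpr (div_le_self k.cast_nonneg hα.le)
    filter_upwards [eventually_gt_atTop 0] with m hm
    have hm' : (0 : ℝ) < m := Nat.cast_pos.mpr hm
    rw [mul_assoc]
    gcongr
    calc (m : ℝ) ^ (k - k / α : ℝ) * (1 + (k - k / α) / (m + 1))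
        ≤ (m : ℝ) ^ (k - k / α : ℝ) *
            (1 + (k - k / α) * (2 * (1 / m : ℝ) / (1 / m + 2))) := by
          have hfrac : 1 / ((m : ℝ) + 1) ≤ 2 * (1 / m) / (1 / m + 2) := by
            rw [div_le_div_iff₀ (by positivity) (by positivity)]
            field_simp
            linarith
          rw [div_eq_mul_one_div (k - k / α : ℝ)]
          gcongr
      _ ≤ (m : ℝ) ^ (k - k / α : ℝ) * (1 + 1 / m) ^ (k - k / α : ℝ) := by
          gcongr
          exact one_add_mul_le_one_add_rpow (by positivity) hq
      _ = ((m + 1 : ℕ) : ℝ) ^ (k - k / α : ℝ) := by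
          rw [← Real.mul_rpow hm'.le (by positivity)]
          congr 1
          push_cast
          field_simp
  spectralRadius_le := hℌ

namespace IsDegreeStable

variable {k : ℕ} {α : ℝ} {𝓕 ℌ : KFamily k}

theorem exists_mem_of_isMaximizer (h : IsDegreeStable 𝓕 ℌ) (hα : 1 < α) (hk : k ≠ 0) :
    ∃ δ : ℝ, 0 < δ ∧ δ < 1 ∧ ∀ᶠ n : ℕ in atTop, ∀ (G : KGraph k (Fin n)) (x : Fin n → ℝ),
      G.Free 𝓕 → G.IsMaximizer α x →
      (turanDensity 𝓕 - δ) * (n : ℝ) ^ (k - k / α : ℝ) ≤ G.spectralRadius α →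
      (∀ v, 1 - δ ≤ n * x v ^ α) → ⟨n, G⟩ ∈ ℌ := by
  obtain ⟨ε, hε, n₀, hn₀⟩ := h
  set π := turanDensity 𝓕
  let φ : ℝ → ℝ := fun δ => (π - δ) * (1 - δ) / (k - 1).factorial - ((1 + δ) ^ (k - 1) - 1)
  have hφ : Continuous φ := by fun_prop
  have hφ0 : π / (k - 1).factorial - ε < φ 0 := by simp [φ, hε]
  obtain ⟨δ, hφδ, hδ0, hδ1⟩ := ((((hφ.tendsto 0).eventually_const_lt hφ0).filter_mono
    nhdsWithin_le_nhds).and (Ioo_mem_nhdsGT (one_pos (α := ℝ)))).exists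
  refine ⟨δ, hδ0, hδ1, ?_⟩
  filter_upwards [eventually_ge_atTop n₀, eventually_gt_atTop 0] with n hn hn0 G x hG hx hρ hbal
  have : Nonempty (Fin n) := ⟨⟨0, hn0⟩⟩
  refine hn₀ n hn G hG ?_
  obtain ⟨v, hv⟩ := exists_eq_ciInf_of_finite (f := fun v => G.degree v)
  rw [KGraph.minDegree, ← hv]
  have hdeg := hx.le_degree hα hk hδ0.le hδ1 (μ := π - δ) (by simpa using hρ)
    (by simpa using hbal) v
  rw [Fintype.card_fin] at hdeg
  exact (mul_le_mul_of_nonneg_right hφδ.le (by positivity)).trans hdeg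

theorem exists_mem_or_exists_comap (h : IsDegreeStable 𝓕 ℌ) (hα : 1 < α) (hk : k ≠ 0) :
    ∃ δ > 0, ∃ c > 0, ∀ b : ℕ → ℝ, IsSpectralMajorant α ℌ b →
      (∀ᶠ n : ℕ in atTop, (turanDensity 𝓕 - δ) * (n : ℝ) ^ (k - k / α : ℝ) ≤ b n) →
      ∀ᶠ m : ℕ in atTop, ∀ G : KGraph k (Fin (m + 1)), G.Free 𝓕 →
        b (m + 1) ≤ G.spectralRadius α →
        (⟨m + 1, G⟩ ∈ ℌ ∧ ∃ x, G.IsMaximizer α x ∧ ∀ v, 0 < x v) ∨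
        ∃ v : Fin (m + 1), G.spectralRadius α / b (m + 1) + c / (m + 1) ≤
          (G.comap v.succAboveEmb).spectralRadius α / b m := by
  obtain ⟨δ, hδ0, hδ1, hmem⟩ := h.exists_mem_of_isMaximizer hα hk
  obtain ⟨c, hc, hgain⟩ := KGraph.exists_gain_of_light_vertex hk hα hδ0
  refine ⟨δ, hδ0, c, hc, fun b hb hδb => ?_⟩
  filter_upwards [hgain, hb.growth, hb.pos, (tendsto_add_atTop_nat 1).eventually hb.pos,
    (tendsto_add_atTop_nat 1).eventually hmem, (tendsto_add_atTop_nat 1).eventually hδb,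
    eventually_gt_atTop 0] with m hgain hgrow hbm hbm1 hmem hδb hm G hG hbG
  obtain ⟨x, hx⟩ := G.exists_isMaximizer (one_pos.trans hα)
  by_cases hbal : ∀ v, 1 - δ ≤ ((m + 1 : ℕ) : ℝ) * x v ^ α
  · refine Or.inl ⟨hmem G x hG hx (hδb.trans hbG) hbal, x, hx, fun v => ?_⟩
    refine (hx.nonneg v).lt_of_ne fun h0 => ?_
    have := hbal v
    rw [← h0, Real.zero_rpow (one_pos.trans hα).ne'] at this
    linarith
  · push Not at hbal
    obtain ⟨v, hv⟩ := hbal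
    have hρ := hgain G x v hx (by exact_mod_cast hv.le)
    have : Nonempty (Fin m) := ⟨⟨0, hm⟩⟩
    refine Or.inr ⟨v, ?_⟩
    set ρ' := (G.comap v.succAboveEmb).spectralRadius α
    have hρ' : 0 ≤ ρ' := KGraph.spectralRadius_nonneg (one_pos.trans hα) _
    calc G.spectralRadius α / b (m + 1) + c / (m + 1)
        ≤ G.spectralRadius α / b (m + 1) + G.spectralRadius α / b (m + 1) * (c / (m + 1)) := by
          gcongr
          exact le_mul_of_one_le_left (by positivity) ((one_le_div hbm1).mpr hbG)
      _ = G.spectralRadius α * (1 + c / (m + 1)) / b (m + 1) := by ring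
      _ ≤ ρ' / b m := by
          rw [div_le_div_iff₀ hbm1 hbm]
          calc G.spectralRadius α * (1 + c / (m + 1)) * b m
              ≤ ρ' * (1 + (k - k / α) / (m + 1)) * b m := by gcongr
            _ = ρ' * (b m * (1 + (k - k / α) / (m + 1))) := by ring
            _ ≤ ρ' * b (m + 1) := by gcongr

theorem exists_eventually_spectralRadius_le (h : IsDegreeStable 𝓕 ℌ) (hα : 1 < α) (hk : k ≠ 0) :
    ∃ δ > 0, ∀ b : ℕ → ℝ, IsSpectralMajorant α ℌ b →
      (∀ᶠ n : ℕ in atTop, (turanDensity 𝓕 - δ) * (n : ℝ) ^ (k - k / α : ℝ) ≤ b n) →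
      ∀ᶠ n in atTop, ∀ G : KGraph k (Fin n), G.Free 𝓕 → G.spectralRadius α ≤ b n ∧
        (G.spectralRadius α = b n → ⟨n, G⟩ ∈ ℌ ∧ ∃ x, G.IsMaximizer α x ∧ ∀ v, 0 < x v) := by
  obtain ⟨δ, hδ, c, hc, hcases⟩ := h.exists_mem_or_exists_comap hα hk
  refine ⟨δ, hδ, fun b hb hδb => ?_⟩
  have hcases := hcases b hb hδb
  have hdiv : ¬ Summable fun m : ℕ => c / ((m : ℝ) + 1) := by
    intro hsum
    refine Real.not_summable_one_div_natCast ((summable_nat_add_iff 1).mp ?_)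
    simpa [div_eq_mul_inv, summable_mul_left_iff hc.ne'] using hsum
  have hratio : ∀ᶠ n in atTop, ∀ G : {G : KGraph k (Fin n) // G.Free 𝓕},
      G.1.spectralRadius α / b n ≤ 1 := by
    refine eventually_forall_le_of_descent (fun n => (Set.finite_range _).bddAbove)
      (fun m => by positivity) hdiv ?_
    filter_upwards [hcases, (tendsto_add_atTop_nat 1).eventually hb.pos,
      (tendsto_add_atTop_nat 1).eventually hb.spectralRadius_le] with m hcases hbm hℌ G hG
    rw [one_lt_div hbm] at hG
    rcases hcases G.1 G.2 hG.le with ⟨hmem, -⟩ | ⟨v, hv⟩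
    · exact absurd (hℌ G.1 hmem) hG.not_ge
    · exact ⟨⟨_, G.2.comap v.succAboveEmb⟩, hv⟩
  rw [← map_add_atTop_eq_nat 1, eventually_map]
  filter_upwards [hcases, hratio, (tendsto_add_atTop_nat 1).eventually hratio,
    (tendsto_add_atTop_nat 1).eventually hb.pos] with m hcases hratio hratio1 hb1 G hG
  refine ⟨(div_le_one hb1).mp (hratio1 ⟨G, hG⟩), fun heq => ?_⟩
  refine (hcases G hG heq.ge).resolve_right ?_
  rintro ⟨v, hv⟩
  rw [heq, div_self hb1.ne'] at hv
  have : 0 < c / ((m : ℝ) + 1) := by positivity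
  linarith [hratio ⟨_, hG.comap v.succAboveEmb⟩]

theorem turanDensity_le (h : IsDegreeStable 𝓕 ℌ) (hα : 1 < α) (hk : k ≠ 0) {L : ℝ} (hL : 0 ≤ L)
    (hℌ : ∀ᶠ n : ℕ in atTop, ∀ H : KGraph k (Fin n), ⟨n, H⟩ ∈ ℌ →
      H.spectralRadius α ≤ L * (n : ℝ) ^ (k - k / α : ℝ)) :
    turanDensity 𝓕 ≤ L := by
  obtain ⟨δ, hδ, hbound⟩ := h.exists_eventually_spectralRadius_le hα hk
  by_contra! hlt
  obtain ⟨μ, hμ, hμπ⟩ := exists_between (max_lt hlt (sub_lt_self (turanDensity 𝓕) hδ))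
  obtain ⟨hLμ, hδμ⟩ := max_lt_iff.mp hμ
  have hfree := hbound _
    (IsSpectralMajorant.const_mul_rpow hα (hL.trans_lt hLμ) (hℌ.mono fun n hn H hH =>
      (hn H hH).trans (mul_le_mul_of_nonneg_right hLμ.le (by positivity))))
    (Eventually.of_forall fun n => mul_le_mul_of_nonneg_right hδμ.le (by positivity))
  refine hμπ.not_ge (le_of_tendsto tendsto_factorial_mul_turanNumber_div_pow ?_)
  filter_upwards [hfree, eventually_gt_atTop 0] with n hn hn0
  have hn0' : (0 : ℝ) < n := Nat.cast_pos.mpr hn0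
  have : Nonempty (Fin n) := ⟨⟨0, hn0⟩⟩
  have hedges : turanNumber n 𝓕 ≤ ⌊μ * (n : ℝ) ^ k / k.factorial⌋₊ := by
    refine turanNumber_le fun G hG => Nat.le_floor ?_
    rw [le_div_iff₀' (by positivity)]
    calc k.factorial * (G.edges.card : ℝ)
        ≤ G.spectralRadius α * (n : ℝ) ^ (k / α : ℝ) := by
          simpa using G.factorial_mul_card_edges_le (one_pos.trans hα) hk
      _ ≤ μ * (n : ℝ) ^ (k - k / α : ℝ) * (n : ℝ) ^ (k / α : ℝ) := by
          gcongr
          exact (hn G hG).1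
      _ = μ * (n : ℝ) ^ k := by
          rw [mul_assoc, ← Real.rpow_add hn0', sub_add_cancel, Real.rpow_natCast]
  rw [div_le_iff₀ (by positivity), ← le_div_iff₀' (by positivity)]
  exact (Nat.cast_le.mpr hedges).trans
    (Nat.floor_le (div_nonneg (mul_nonneg (hL.trans hLμ.le) (by positivity)) (by positivity)))

theorem eventually_spectralRadius_le (h : IsDegreeStable 𝓕 ℌ) (hα : 1 < α) (hk : k ≠ 0)
    {b : ℕ → ℝ} (hb : IsSpectralMajorant α ℌ b) {L : ℝ} (hL : 0 ≤ L)
    (hℌ : ∀ᶠ n : ℕ in atTop, ∀ H : KGraph k (Fin n), ⟨n, H⟩ ∈ ℌ →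
      H.spectralRadius α ≤ L * (n : ℝ) ^ (k - k / α : ℝ))
    (hbL : Tendsto (fun n : ℕ => b n / (n : ℝ) ^ (k - k / α : ℝ)) atTop (𝓝 L)) :
    ∀ᶠ n in atTop, ∀ G : KGraph k (Fin n), G.Free 𝓕 → G.spectralRadius α ≤ b n ∧
      (G.spectralRadius α = b n → ⟨n, G⟩ ∈ ℌ ∧ ∃ x, G.IsMaximizer α x ∧ ∀ v, 0 < x v) := by
  obtain ⟨δ, hδ, hbound⟩ := h.exists_eventually_spectralRadius_le hα hk
  refine hbound b hb ?_
  have hlt : turanDensity 𝓕 - δ < L := by linarith [h.turanDensity_le hα hk hL hℌ]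
  filter_upwards [hbL.eventually_const_lt hlt, eventually_gt_atTop 0] with n hn hn0
  exact ((lt_div_iff₀ (by positivity)).mp hn).le

end IsDegreeStable

/-- The `α`-spectral radius of the complete split `4`-graph with parts of sizes `a` and `b`, as a
function of `β = 2 - 2 / α`. -/
noncomputable def splitValue (β : ℝ) (a b : ℕ) : ℝ :=
  3 / 8 * ((1 - 1 / a) * (1 - 1 / b)) * (4 * (a * b)) ^ β

theorem splitValue_comm (β : ℝ) (a b : ℕ) : splitValue β a b = splitValue β b a := by
  simp only [splitValue, mul_comm]

theorem one_sub_one_div_natCast_nonneg (a : ℕ) : (0 : ℝ) ≤ 1 - 1 / a := by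
  rw [one_div]
  exact sub_nonneg.mpr (Nat.cast_inv_le_one a)

theorem splitValue_pos {β : ℝ} {a b : ℕ} (ha : 2 ≤ a) (hb : 2 ≤ b) : 0 < splitValue β a b := by
  have hsub {c : ℕ} (hc : 2 ≤ c) : (0 : ℝ) < 1 - 1 / c := by
    rw [sub_pos, div_lt_one (by positivity)]
    exact_mod_cast hc
  have := hsub ha
  have := hsub hb
  unfold splitValue
  positivity

theorem splitValue_lt_splitValue {β : ℝ} (hβ : 0 ≤ β) {a b c d : ℕ} (ha : 0 < a) (hb : 0 < b)
    (hsum : a + b = c + d) (hmul : a * b < c * d) : splitValue β a b < splitValue β c d := by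
  have hform {a b : ℕ} (hab : 0 < a * b) :
      (1 - 1 / a : ℝ) * (1 - 1 / b) = 1 - (((a + b : ℕ) : ℝ) - 1) / (a * b : ℕ) := by
    have : (a : ℝ) ≠ 0 := Nat.cast_ne_zero.mpr (Nat.pos_of_mul_pos_right hab).ne'
    have : (b : ℝ) ≠ 0 := Nat.cast_ne_zero.mpr (Nat.pos_of_mul_pos_left hab).ne'
    push_cast
    field_simp
    ring
  have hab : 0 < a * b := Nat.mul_pos ha hb
  have hmul' : (a : ℝ) * b < c * d := by exact_mod_cast hmul
  have hfac : (1 - 1 / a : ℝ) * (1 - 1 / b) < (1 - 1 / c) * (1 - 1 / d) := by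
    rw [hform hab, hform (hab.trans hmul), ← hsum]
    refine sub_lt_sub_left (div_lt_div_of_pos_left ?_ (by positivity) (by exact_mod_cast hmul)) _
    rw [sub_pos, Nat.one_lt_cast]
    lia
  refine mul_lt_mul (by gcongr) (by gcongr) (by positivity) ?_
  exact mul_nonneg (by norm_num)
    (mul_nonneg (one_sub_one_div_natCast_nonneg c) (one_sub_one_div_natCast_nonneg d))

theorem mul_lt_half_mul_half {a b : ℕ} (ha : a ≠ (a + b) / 2) (hb : b ≠ (a + b) / 2) :
    a * b < (a + b) / 2 * ((a + b + 1) / 2) := by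
  wlog hab : a ≤ b generalizing a b
  · rw [mul_comm a b, add_comm a b]
    exact this (by rwa [add_comm]) (by rwa [add_comm]) (by lia)
  obtain ⟨d, hd⟩ : ∃ d, (a + b) / 2 = a + d := Nat.exists_eq_add_of_le (by lia)
  obtain ⟨c, hc⟩ : ∃ c, (a + b + 1) / 2 = c := ⟨_, rfl⟩
  rw [hd, hc, show b = c + d by lia]
  nlinarith [show 0 < d by lia, show a < c by lia]

theorem splitValue_lt_splitValue_half {β : ℝ} (hβ : 0 < β) {a b : ℕ} (hab : 4 ≤ a + b)
    (ha : a ≠ (a + b) / 2) (hb : b ≠ (a + b) / 2) :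
    splitValue β a b < splitValue β ((a + b) / 2) ((a + b + 1) / 2) := by
  by_cases h0 : a = 0 ∨ b = 0
  · have : splitValue β a b = 0 := by
      rcases h0 with rfl | rfl <;> simp [splitValue, Real.zero_rpow hβ.ne']
    rw [this]
    exact splitValue_pos (by lia) (by lia)
  · push Not at h0
    exact splitValue_lt_splitValue hβ.le (Nat.pos_of_ne_zero h0.1) (Nat.pos_of_ne_zero h0.2)
      (by lia) (mul_lt_half_mul_half ha hb)

theorem splitValue_mul_le_splitValue_succ {β : ℝ} (hβ : 0 ≤ β) {a b : ℕ} (ha : 0 < a)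
    (hab : a ≤ b) :
    splitValue β a b * (1 + 2 * β / (a + b + 1)) ≤ splitValue β (a + 1) b := by
  have ha' : (0 : ℝ) < a := Nat.cast_pos.mpr ha
  have hab' : (a : ℝ) ≤ b := Nat.cast_le.mpr hab
  have hpow : 1 + 2 * β / (a + b + 1) ≤ (1 + 1 / a : ℝ) ^ β := by
    refine le_trans ?_ (one_add_mul_le_one_add_rpow (by positivity) hβ)
    rw [mul_comm 2 β, mul_div_assoc]
    gcongr 1 + β * ?_
    rw [div_le_div_iff₀ (by positivity) (by positivity)]
    field_simp
    linarith
  have ha1 := one_sub_one_div_natCast_nonneg a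
  have hb1 := one_sub_one_div_natCast_nonneg b
  calc splitValue β a b * (1 + 2 * β / (a + b + 1))
      ≤ splitValue β a b * (1 + 1 / a : ℝ) ^ β := by
        have : 0 ≤ splitValue β a b := by unfold splitValue; positivity
        gcongr
    _ = 3 / 8 * ((1 - 1 / a) * (1 - 1 / b)) * (4 * ((a + 1 : ℕ) * b)) ^ β := by
        rw [splitValue, mul_assoc _ _ ((1 + 1 / a : ℝ) ^ β),
          ← Real.mul_rpow (by positivity) (by positivity)]
        congr 2
        push_cast
        field_simp
    _ ≤ splitValue β (a + 1) b := by
        unfold splitValue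
        gcongr
        exact Nat.le_succ a

theorem splitValue_le {β : ℝ} (hβ : 0 ≤ β) (a b : ℕ) :
    splitValue β a b ≤ 3 / 8 * ((a + b : ℕ) : ℝ) ^ (2 * β) := by
  have hb := one_sub_one_div_natCast_nonneg b
  calc splitValue β a b
      ≤ 3 / 8 * (1 * 1) * (((a + b : ℕ) : ℝ) ^ 2) ^ β := by
        unfold splitValue
        gcongr
        · exact sub_le_self _ (by positivity)
        · exact sub_le_self _ (by positivity)
        · push_cast
          nlinarith [sq_nonneg ((a : ℝ) - b)]
    _ = 3 / 8 * ((a + b : ℕ) : ℝ) ^ (2 * β) := by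
        rw [← Real.rpow_natCast_mul (by positivity)]
        norm_num

theorem tendsto_splitValue_half_div_rpow (β : ℝ) :
    Tendsto (fun n : ℕ => splitValue β (n / 2) ((n + 1) / 2) / (n : ℝ) ^ (2 * β)) atTop
      (𝓝 (3 / 8)) := by
  have hhalf : Tendsto (fun n : ℕ => n / 2) atTop atTop :=
    Nat.tendsto_div_const_atTop two_ne_zero
  have hinv {f : ℕ → ℕ} (hf : Tendsto f atTop atTop) :
      Tendsto (fun n => 1 - 1 / (f n : ℝ)) atTop (𝓝 1) := by
    simpa using (tendsto_one_div_atTop_nhds_zero_nat (𝕜 := ℝ).comp hf).const_sub 1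
  have hsq : Tendsto (fun n : ℕ => 4 * (((n / 2 : ℕ) : ℝ) * ((n + 1) / 2 : ℕ)) / (n : ℝ) ^ 2)
      atTop (𝓝 1) := by
    have hlow : Tendsto (fun n : ℕ => 1 - 1 / (n : ℝ)) atTop (𝓝 1) := hinv tendsto_id
    refine tendsto_of_tendsto_of_tendsto_of_le_of_le' hlow tendsto_const_nhds ?_ ?_
    · filter_upwards [eventually_gt_atTop 0] with n hn
      have : (1 : ℝ) ≤ n := Nat.one_le_cast.mpr hn
      have h1 : (n : ℝ) ≤ 2 * (n / 2 : ℕ) + 1 := by exact_mod_cast (by lia)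
      have h2 : (n : ℝ) ≤ 2 * ((n + 1) / 2 : ℕ) := by exact_mod_cast (by lia)
      rw [le_div_iff₀ (by positivity)]
      field_simp
      nlinarith
    · refine Eventually.of_forall fun n => div_le_one_of_le₀ ?_ (by positivity)
      have h : (n : ℝ) = (n / 2 : ℕ) + ((n + 1) / 2 : ℕ) := by exact_mod_cast (by lia)
      rw [h]
      nlinarith [sq_nonneg (((n / 2 : ℕ) : ℝ) - ((n + 1) / 2 : ℕ))]
  have hlim := (((hinv hhalf).mul (hinv (hhalf.comp (tendsto_add_atTop_nat 1)))).const_mul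
    (3 / 8)).mul (hsq.rpow_const (p := β) (Or.inl one_ne_zero))
  simp only [mul_one, Real.one_rpow] at hlim
  refine hlim.congr fun n => ?_
  rw [Real.div_rpow (by positivity) (by positivity), ← Real.rpow_natCast_mul n.cast_nonneg,
    ← mul_div_assoc]
  rfl

theorem two_mul_sum_powersetCard_two {V : Type*} (A : Finset V) (x : V → ℝ) :
    2 * ∑ s ∈ A.powersetCard 2, ∏ v ∈ s, x v = (∑ v ∈ A, x v) ^ 2 - ∑ v ∈ A, x v ^ 2 := by
  classical
  induction A using Finset.induction_on with
  | empty => rw [Finset.powersetCard_eq_empty.mpr (by simp)]; simp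
  | insert a A ha ih =>
    rw [Finset.powersetCard_succ_insert ha, Finset.sum_union, mul_add, ih, Finset.sum_image,
      Finset.sum_insert ha, Finset.sum_insert ha, Finset.powersetCard_one, Finset.sum_map]
    · have : ∑ v ∈ A, ∏ u ∈ insert a ((⟨_, Finset.singleton_injective⟩ : V ↪ Finset V) v), x u
          = x a * ∑ v ∈ A, x v := by
        rw [Finset.mul_sum]
        refine Finset.sum_congr rfl fun v hv => ?_
        have hav : a ≠ v := by rintro rfl; exact ha hv
        simp [Finset.prod_pair hav]
      rw [this]
      ring
    · intro s hs t ht hst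
      have has : a ∉ s := fun h => ha ((Finset.mem_powersetCard.mp hs).1 h)
      have hat : a ∉ t := fun h => ha ((Finset.mem_powersetCard.mp ht).1 h)
      rw [← Finset.erase_insert has, hst, Finset.erase_insert hat]
    · rw [Finset.disjoint_left]
      intro s hs hs'
      obtain ⟨t, _, rfl⟩ := Finset.mem_image.mp hs'
      exact ha ((Finset.mem_powersetCard.mp hs).1 (Finset.mem_insert_self _ _))

theorem sq_sum_sub_sum_sq_nonneg {V : Type*} (A : Finset V) {x : V → ℝ} (hx : ∀ v, 0 ≤ x v) :
    0 ≤ (∑ v ∈ A, x v) ^ 2 - ∑ v ∈ A, x v ^ 2 := by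
  classical
  rw [← two_mul_sum_powersetCard_two]
  exact mul_nonneg zero_le_two
    (Finset.sum_nonneg fun s _ => Finset.prod_nonneg fun v _ => hx v)

theorem sq_sum_sub_sum_sq_le {V : Type*} (A : Finset V) (x : V → ℝ) :
    (∑ v ∈ A, x v) ^ 2 - ∑ v ∈ A, x v ^ 2 ≤ (1 - 1 / (A.card : ℝ)) * (∑ v ∈ A, x v) ^ 2 := by
  have hcauchy : (∑ v ∈ A, x v) ^ 2 / A.card ≤ ∑ v ∈ A, x v ^ 2 := by
    rw [div_eq_mul_inv]
    exact div_le_of_le_mul₀ (by positivity) (by positivity)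
      (by simpa [mul_comm] using sq_sum_le_card_mul_sum_sq (s := A) (f := x))
  rw [sub_mul, one_mul, one_div_mul_eq_div]
  gcongr

section TwoParts

variable {V : Type*} [Fintype V] [DecidableEq V] {α : ℝ} {x : V → ℝ}

theorem rpow_sum_mul_sum_compl_le (hα : 1 ≤ α) (A : Finset V) (hx : ∀ v, 0 ≤ x v)
    (hx1 : ∑ v, x v ^ α = 1) :
    ((∑ v ∈ A, x v) * ∑ v ∈ Aᶜ, x v) ^ α ≤ ((A.card : ℝ) * Aᶜ.card) ^ (α - 1) * (1 / 4) := by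
  have hsum (B : Finset V) : 0 ≤ ∑ v ∈ B, x v := Finset.sum_nonneg fun v _ => hx v
  have hsumα (B : Finset V) : 0 ≤ ∑ v ∈ B, x v ^ α :=
    Finset.sum_nonneg fun v _ => Real.rpow_nonneg (hx v) α
  have hpow (B : Finset V) := Real.rpow_sum_le_const_mul_sum_rpow_of_nonneg B hα fun v _ => hx v
  rw [← Finset.sum_add_sum_compl A] at hx1
  have hmass : (∑ v ∈ A, x v ^ α) * ∑ v ∈ Aᶜ, x v ^ α ≤ 1 / 4 := by
    nlinarith [sq_nonneg (∑ v ∈ A, x v ^ α - ∑ v ∈ Aᶜ, x v ^ α)]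
  calc ((∑ v ∈ A, x v) * ∑ v ∈ Aᶜ, x v) ^ α
      = (∑ v ∈ A, x v) ^ α * (∑ v ∈ Aᶜ, x v) ^ α := Real.mul_rpow (hsum A) (hsum Aᶜ)
    _ ≤ ((A.card : ℝ) ^ (α - 1) * ∑ v ∈ A, x v ^ α) *
          ((Aᶜ.card : ℝ) ^ (α - 1) * ∑ v ∈ Aᶜ, x v ^ α) :=
        mul_le_mul (hpow A) (hpow Aᶜ) (Real.rpow_nonneg (hsum Aᶜ) α)
          (mul_nonneg (by positivity) (hsumα A))
    _ = ((A.card : ℝ) * Aᶜ.card) ^ (α - 1) * ((∑ v ∈ A, x v ^ α) * ∑ v ∈ Aᶜ, x v ^ α) := by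
        rw [Real.mul_rpow (by positivity) (by positivity)]
        ring
    _ ≤ ((A.card : ℝ) * Aᶜ.card) ^ (α - 1) * (1 / 4) := by gcongr

theorem sq_sum_mul_sum_compl_le (hα : 1 ≤ α) (A : Finset V) (hx : ∀ v, 0 ≤ x v)
    (hx1 : ∑ v, x v ^ α = 1) :
    ((∑ v ∈ A, x v) * ∑ v ∈ Aᶜ, x v) ^ 2 ≤
      (4 * ((A.card : ℝ) * Aᶜ.card)) ^ (2 - 2 / α) / 16 := by
  have hα0 : 0 < α := one_pos.trans_le hα
  have hXY : 0 ≤ (∑ v ∈ A, x v) * ∑ v ∈ Aᶜ, x v :=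
    mul_nonneg (Finset.sum_nonneg fun v _ => hx v) (Finset.sum_nonneg fun v _ => hx v)
  calc ((∑ v ∈ A, x v) * ∑ v ∈ Aᶜ, x v) ^ 2
      = (((∑ v ∈ A, x v) * ∑ v ∈ Aᶜ, x v) ^ α) ^ (2 / α) := by
        rw [← Real.rpow_mul hXY, mul_div_cancel₀ _ hα0.ne', Real.rpow_two]
    _ ≤ (((A.card : ℝ) * Aᶜ.card) ^ (α - 1) * (1 / 4)) ^ (2 / α) := by
        gcongr
        exact rpow_sum_mul_sum_compl_le hα A hx hx1
    _ = ((A.card : ℝ) * Aᶜ.card) ^ (2 - 2 / α) * (4 : ℝ) ^ (-(2 / α)) := by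
        rw [Real.mul_rpow (by positivity) (by positivity), ← Real.rpow_mul (by positivity),
          one_div, Real.inv_rpow (by norm_num), Real.rpow_neg (by norm_num)]
        congr 2
        field_simp
    _ = (4 * ((A.card : ℝ) * Aᶜ.card)) ^ (2 - 2 / α) / 16 := by
        rw [Real.mul_rpow (x := 4) (by norm_num) (by positivity), sub_eq_add_neg 2 (2 / α),
          Real.rpow_add (by norm_num : (0 : ℝ) < 4)]
        norm_num
        ring

end TwoParts

theorem sq_mul_rpow_one_div_mul_sq (α : ℝ) {a b : ℝ} (ha : 0 < a) (hb : 0 < b) :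
    ((1 / (2 * a)) ^ (1 / α) * (1 / (2 * b)) ^ (1 / α)) ^ 2 * (4 * (a * b)) ^ 2 =
      (4 * (a * b)) ^ (2 - 2 / α) := by
  have hinv : 1 / (2 * a) * (1 / (2 * b)) = (4 * (a * b))⁻¹ := by
    field_simp
    norm_num
  rw [← Real.mul_rpow (by positivity) (by positivity), hinv,
    ← Real.rpow_mul_natCast (by positivity), Real.inv_rpow (by positivity),
    ← Real.rpow_neg (by positivity), ← Real.rpow_natCast, ← Real.rpow_add (by positivity)]
  congr 1
  push_cast
  ring

namespace KGraph

section Subgraph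

variable {k : ℕ} {V : Type*} {G H : KGraph k V} {x : V → ℝ}

theorem lagrangian_mono (h : G.edges ⊆ H.edges) (hx : ∀ v, 0 ≤ x v) :
    G.lagrangian x ≤ H.lagrangian x :=
  mul_le_mul_of_nonneg_left
    (Finset.sum_le_sum_of_subset_of_nonneg h fun _ _ _ => Finset.prod_nonneg fun v _ => hx v)
    (Nat.cast_nonneg _)

theorem spectralRadius_mono [Fintype V] [Nonempty V] {α : ℝ} (hα : 0 < α)
    (h : G.edges ⊆ H.edges) : G.spectralRadius α ≤ H.spectralRadius α :=
  spectralRadius_le hα G fun _ hx hx1 =>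
    (lagrangian_mono h hx).trans (H.lagrangian_le_spectralRadius hα hx hx1)

theorem eq_of_lagrangian_le (h : G.edges ⊆ H.edges) (hx : ∀ v, 0 < x v)
    (hle : H.lagrangian x ≤ G.lagrangian x) : G = H := by
  refine KGraph.ext (h.antisymm fun e he => ?_)
  by_contra heG
  refine hle.not_gt (mul_lt_mul_of_pos_left ?_ (by positivity))
  exact Finset.sum_lt_sum_of_subset h he heG (Finset.prod_pos fun v _ => hx v)
    fun _ _ _ => Finset.prod_nonneg fun v _ => (hx v).le

end Subgraph

section CompleteSplit

variable {V : Type*} [Fintype V] [DecidableEq V] {α : ℝ}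

/-- The `4`-graph of all `4`-sets with two vertices in `A` and two outside `A`; these are the
maximal `patternB4`-colorable `4`-graphs. -/
def completeSplit (A : Finset V) : KGraph 4 V where
  edges := Finset.univ.filter fun e => (e ∩ A).card = 2 ∧ (e \ A).card = 2
  uniform e he := by
    obtain ⟨h1, h2⟩ := (Finset.mem_filter.mp he).2
    rw [← Finset.card_inter_add_card_sdiff e A, h1, h2]

theorem mem_completeSplit {A e : Finset V} :
    e ∈ (completeSplit A).edges ↔ (e ∩ A).card = 2 ∧ (e \ A).card = 2 := by
  simp [completeSplit]

theorem sum_completeSplit (A : Finset V) (x : V → ℝ) :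
    ∑ e ∈ (completeSplit A).edges, ∏ v ∈ e, x v =
      (∑ s ∈ A.powersetCard 2, ∏ v ∈ s, x v) * ∑ s ∈ Aᶜ.powersetCard 2, ∏ v ∈ s, x v := by
  have hunion {s t : Finset V} (hs : s ⊆ A) (ht : t ⊆ Aᶜ) : (s ∪ t) ∩ A = s ∧ (s ∪ t) \ A = t := by
    constructor <;> ext v <;> grind [Finset.mem_compl]
  rw [Finset.sum_mul_sum, ← Finset.sum_product']
  refine Finset.sum_nbij' (fun e => (e ∩ A, e \ A)) (fun p => p.1 ∪ p.2) ?_ ?_ ?_ ?_ ?_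
  · intro e he
    rw [Finset.mem_product, Finset.mem_powersetCard, Finset.mem_powersetCard]
    obtain ⟨hin, hout⟩ := mem_completeSplit.mp he
    exact ⟨⟨Finset.inter_subset_right, hin⟩, fun v hv =>
      Finset.mem_compl.mpr (Finset.mem_sdiff.mp hv).2, hout⟩
  · rintro ⟨s, t⟩ hst
    simp only [Finset.mem_product, Finset.mem_powersetCard] at hst
    obtain ⟨hin, hout⟩ := hunion hst.1.1 hst.2.1
    rw [mem_completeSplit, hin, hout]
    exact ⟨hst.1.2, hst.2.2⟩
  · intro e _
    exact sup_inf_sdiff e A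
  · rintro ⟨s, t⟩ hst
    simp only [Finset.mem_product, Finset.mem_powersetCard] at hst
    obtain ⟨hin, hout⟩ := hunion hst.1.1 hst.2.1
    rw [hin, hout]
  · intro e _
    rw [← Finset.prod_inter_mul_prod_sdiff e A]

theorem lagrangian_completeSplit (A : Finset V) (x : V → ℝ) :
    (completeSplit A).lagrangian x =
      6 * (((∑ v ∈ A, x v) ^ 2 - ∑ v ∈ A, x v ^ 2) *
        ((∑ v ∈ Aᶜ, x v) ^ 2 - ∑ v ∈ Aᶜ, x v ^ 2)) := by
  rw [← two_mul_sum_powersetCard_two, ← two_mul_sum_powersetCard_two, lagrangian,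
    sum_completeSplit, show Nat.factorial 4 = 24 from rfl]
  push_cast
  ring

theorem lagrangian_completeSplit_le (hα : 1 ≤ α) (A : Finset V) {x : V → ℝ} (hx : ∀ v, 0 ≤ x v)
    (hx1 : ∑ v, x v ^ α = 1) :
    (completeSplit A).lagrangian x ≤ splitValue (2 - 2 / α) A.card Aᶜ.card := by
  have hA := one_sub_one_div_natCast_nonneg A.card
  have hB := one_sub_one_div_natCast_nonneg Aᶜ.card
  rw [lagrangian_completeSplit]
  calc 6 * (((∑ v ∈ A, x v) ^ 2 - ∑ v ∈ A, x v ^ 2) *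
          ((∑ v ∈ Aᶜ, x v) ^ 2 - ∑ v ∈ Aᶜ, x v ^ 2))
      ≤ 6 * ((1 - 1 / A.card) * (∑ v ∈ A, x v) ^ 2 *
          ((1 - 1 / Aᶜ.card) * (∑ v ∈ Aᶜ, x v) ^ 2)) := by
        gcongr
        · exact sq_sum_sub_sum_sq_nonneg Aᶜ hx
        · exact sq_sum_sub_sum_sq_le A x
        · exact sq_sum_sub_sum_sq_le Aᶜ x
    _ = 6 * ((1 - 1 / A.card) * (1 - 1 / Aᶜ.card)) * ((∑ v ∈ A, x v) * ∑ v ∈ Aᶜ, x v) ^ 2 := by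
        ring
    _ ≤ 6 * ((1 - 1 / A.card) * (1 - 1 / Aᶜ.card)) *
          ((4 * ((A.card : ℝ) * Aᶜ.card)) ^ (2 - 2 / α) / 16) := by
        gcongr
        exact sq_sum_mul_sum_compl_le hα A hx hx1
    _ = splitValue (2 - 2 / α) A.card Aᶜ.card := by
        unfold splitValue
        ring

theorem splitValue_le_spectralRadius_completeSplit (hα : 0 < α) {A : Finset V} (hA : A.Nonempty)
    (hB : Aᶜ.Nonempty) :
    splitValue (2 - 2 / α) A.card Aᶜ.card ≤ (completeSplit A).spectralRadius α := by
  have ha : (0 : ℝ) < A.card := Nat.cast_pos.mpr hA.card_pos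
  have hb : (0 : ℝ) < Aᶜ.card := Nat.cast_pos.mpr hB.card_pos
  -- the optimal vector gives each part half of the total mass, evenly distributed
  set p : ℝ := (1 / (2 * A.card)) ^ (1 / α) with hp
  set q : ℝ := (1 / (2 * Aᶜ.card)) ^ (1 / α) with hq
  let x : V → ℝ := fun v => if v ∈ A then p else q
  have hsumA (f : ℝ → ℝ) : ∑ v ∈ A, f (x v) = A.card * f p := by
    rw [Finset.sum_congr rfl fun v hv => congrArg f (if_pos hv), Finset.sum_const, nsmul_eq_mul]
  have hsumB (f : ℝ → ℝ) : ∑ v ∈ Aᶜ, f (x v) = Aᶜ.card * f q := by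
    rw [Finset.sum_congr rfl fun v hv => congrArg f (if_neg (Finset.mem_compl.mp hv)),
      Finset.sum_const, nsmul_eq_mul]
  have hx (v : V) : 0 ≤ x v := by
    dsimp only [x]
    positivity
  have hx1 : ∑ v, x v ^ α = 1 := by
    rw [← Finset.sum_add_sum_compl A, hsumA (· ^ α), hsumB (· ^ α), hp, hq,
      ← Real.rpow_mul (by positivity), ← Real.rpow_mul (by positivity),
      one_div_mul_cancel hα.ne', Real.rpow_one, Real.rpow_one]
    field_simp
    norm_num
  have hpq : (p * q) ^ 2 * (4 * ((A.card : ℝ) * Aᶜ.card)) ^ 2 =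
      (4 * ((A.card : ℝ) * Aᶜ.card)) ^ (2 - 2 / α) :=
    sq_mul_rpow_one_div_mul_sq α ha hb
  refine le_trans (le_of_eq ?_) (lagrangian_le_spectralRadius hα _ hx hx1)
  rw [lagrangian_completeSplit, hsumA (fun r => r), hsumB (fun r => r), hsumA (· ^ 2),
    hsumB (· ^ 2), splitValue, ← hpq]
  field_simp
  ring

theorem spectralRadius_completeSplit_le [Nonempty V] (hα : 1 ≤ α) (A : Finset V) :
    (completeSplit A).spectralRadius α ≤ splitValue (2 - 2 / α) A.card Aᶜ.card :=
  spectralRadius_le (one_pos.trans_le hα) _ fun _ hx hx1 => lagrangian_completeSplit_le hα A hx hx1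

theorem spectralRadius_completeSplit (hα : 1 ≤ α) {A : Finset V} (hA : A.Nonempty)
    (hB : Aᶜ.Nonempty) :
    (completeSplit A).spectralRadius α = splitValue (2 - 2 / α) A.card Aᶜ.card := by
  have : Nonempty V := hA.to_type
  exact (spectralRadius_completeSplit_le hα A).antisymm
    (splitValue_le_spectralRadius_completeSplit (one_pos.trans_le hα) hA hB)

theorem completeSplit_compl (A : Finset V) : completeSplit Aᶜ = completeSplit A := by
  ext e
  rw [mem_completeSplit, mem_completeSplit, and_comm, sdiff_compl, Finset.inf_eq_inter,
    Finset.sdiff_eq_inter_compl]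

theorem completeSplit_iso {A B : Finset V} (h : A.card = B.card) :
    (completeSplit A).Iso (completeSplit B) := by
  have e : {v // v ∈ A} ≃ {v // v ∈ B} := Finset.equivOfCardEq h
  obtain ⟨σ, hσ⟩ : ∃ σ : Equiv.Perm V, ∀ v, σ v ∈ B ↔ v ∈ A := ⟨e.extendSubtype, fun v =>
    ⟨fun hv => by_contra fun hA => e.extendSubtype_not_mem v hA hv, e.extendSubtype_mem v⟩⟩
  obtain rfl : A.map σ.toEmbedding = B := by
    ext v
    obtain ⟨u, rfl⟩ := σ.surjective v
    simp [hσ]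
  refine ⟨σ, fun s => ?_⟩
  rw [mem_completeSplit, mem_completeSplit, ← Finset.map_inter, ← Finset.map_sdiff,
    Finset.card_map, Finset.card_map]

end CompleteSplit

theorem colorable_patternB4_iff {V : Type*} [Fintype V] [DecidableEq V] {G : KGraph 4 V} :
    G.Colorable patternB4 ↔ ∃ A : Finset V, G.edges ⊆ (completeSplit A).edges := by
  have hcolor (A : Finset V) (φ : V → Fin 2) (hφ : ∀ v, φ v = 0 ↔ v ∈ A) (e : Finset V) :
      e.val.map φ = ({0, 0, 1, 1} : Multiset (Fin 2)) ↔ e ∈ (completeSplit A).edges := by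
    have hin : e ∩ A = e.filter fun v => φ v = 0 := by ext v; simp [hφ]
    have hout : e \ A = e.filter fun v => φ v = 1 := by
      ext v
      rw [Finset.mem_sdiff, Finset.mem_filter, ← hφ]
      exact and_congr_right fun _ => by omega
    have hcount (i : Fin 2) : (e.val.map φ).count i = (e.filter fun v => φ v = i).card := by
      rw [Multiset.count_map]
      simp [Finset.card_def, eq_comm]
    rw [mem_completeSplit, hin, hout, ← hcount, ← hcount, Multiset.ext, Fin.forall_fin_two]
    exact Iff.rfl
  constructor
  · rintro ⟨φ : V → Fin 2, hφ⟩
    exact ⟨Finset.univ.filter fun v => φ v = 0, fun e he =>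
      (hcolor _ φ (by simp) e).mp (hφ e he)⟩
  · rintro ⟨A, hA⟩
    exact ⟨(fun v => if v ∈ A then 0 else 1 : V → Fin 2), fun e he =>
      (hcolor A _ (by simp) e).mpr (hA he)⟩

end KGraph

/-- The part `{v | v < ⌊n/2⌋}` of `B4 n`. -/
def B4Part (n : ℕ) : Finset (Fin n) := Finset.univ.filter fun v => v.val < n / 2

theorem card_B4Part (n : ℕ) : (B4Part n).card = n / 2 := by
  rw [B4Part, Fin.card_filter_val_lt, min_eq_right (Nat.div_le_self n 2)]

theorem card_compl_B4Part (n : ℕ) : (B4Part n)ᶜ.card = (n + 1) / 2 := by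
  rw [Finset.card_compl, card_B4Part, Fintype.card_fin]
  lia

theorem B4_eq_completeSplit (n : ℕ) : B4 n = KGraph.completeSplit (B4Part n) := by
  ext e
  have hin : e ∩ B4Part n = e.filter fun v => v.val < n / 2 := by ext v; simp [B4Part]
  have hout : e \ B4Part n = e.filter fun v => ¬ v.val < n / 2 := by ext v; simp [B4Part]
  rw [KGraph.mem_completeSplit, hin, hout]
  simp [B4]

theorem spectralRadius_B4 {α : ℝ} (hα : 1 ≤ α) {n : ℕ} (hn : 2 ≤ n) :
    (B4 n).spectralRadius α = splitValue (2 - 2 / α) (n / 2) ((n + 1) / 2) := by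
  rw [B4_eq_completeSplit, KGraph.spectralRadius_completeSplit hα, card_B4Part, card_compl_B4Part]
  · exact Finset.card_pos.mp (by rw [card_B4Part]; lia)
  · exact Finset.card_pos.mp (by rw [card_compl_B4Part]; lia)

namespace KGraph

theorem completeSplit_iso_B4_or_spectralRadius_lt {α : ℝ} (hα : 1 < α) {n : ℕ} (hn : 4 ≤ n)
    (A : Finset (Fin n)) :
    (completeSplit A).Iso (B4 n) ∨
      (completeSplit A).spectralRadius α < (B4 n).spectralRadius α := by
  have : Nonempty (Fin n) := ⟨⟨0, by lia⟩⟩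
  by_cases hA : A.card = n / 2
  · rw [B4_eq_completeSplit]
    exact Or.inl (completeSplit_iso (by rw [hA, card_B4Part]))
  by_cases hB : Aᶜ.card = n / 2
  · rw [B4_eq_completeSplit, ← completeSplit_compl A]
    exact Or.inl (completeSplit_iso (by rw [hB, card_B4Part]))
  · right
    have hcard : A.card + Aᶜ.card = n := by rw [Finset.card_add_card_compl, Fintype.card_fin]
    have hβ : 0 < 2 - 2 / α := sub_pos.mpr (div_lt_self two_pos hα)
    have hlt := splitValue_lt_splitValue_half hβ (a := A.card) (b := Aᶜ.card)
    rw [hcard] at hlt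
    rw [spectralRadius_B4 hα.le (by lia)]
    exact (spectralRadius_completeSplit_le hα.le A).trans_lt (hlt hn hA hB)

namespace Colorable

variable {n : ℕ} {G : KGraph 4 (Fin n)} {α : ℝ}

theorem spectralRadius_le_B4 (hG : G.Colorable patternB4) (hα : 1 < α) (hn : 4 ≤ n) :
    G.spectralRadius α ≤ (B4 n).spectralRadius α := by
  have : Nonempty (Fin n) := ⟨⟨0, by lia⟩⟩
  obtain ⟨A, hA⟩ := colorable_patternB4_iff.mp hG
  refine (spectralRadius_mono (one_pos.trans hα) hA).trans ?_
  rcases completeSplit_iso_B4_or_spectralRadius_lt hα hn A with hiso | hlt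
  · exact (hiso.spectralRadius_eq α).le
  · exact hlt.le

theorem iso_B4 (hG : G.Colorable patternB4) (hα : 1 < α) (hn : 4 ≤ n) {x : Fin n → ℝ}
    (hx : G.IsMaximizer α x) (hpos : ∀ v, 0 < x v)
    (heq : G.spectralRadius α = (B4 n).spectralRadius α) : G.Iso (B4 n) := by
  have : Nonempty (Fin n) := ⟨⟨0, by lia⟩⟩
  obtain ⟨A, hA⟩ := colorable_patternB4_iff.mp hG
  rcases completeSplit_iso_B4_or_spectralRadius_lt hα hn A with hiso | hlt
  · have hle : (completeSplit A).lagrangian x ≤ G.lagrangian x := by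
      rw [hx.lagrangian_eq, heq, ← hiso.spectralRadius_eq]
      exact lagrangian_le_spectralRadius (one_pos.trans hα) _ hx.nonneg hx.sum_rpow
    rwa [eq_of_lagrangian_le hA hpos hle]
  · exact absurd (spectralRadius_mono (one_pos.trans hα) hA) (heq ▸ hlt).not_ge

end Colorable

end KGraph

theorem natCast_four_sub_div (α : ℝ) : ((4 : ℕ) : ℝ) - (4 : ℕ) / α = 2 * (2 - 2 / α) := by
  push_cast
  ring

theorem isSpectralMajorant_B4 {α : ℝ} (hα : 1 < α) :
    IsSpectralMajorant α patternB4.Col fun n => (B4 n).spectralRadius α where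
  pos := by
    filter_upwards [eventually_ge_atTop 4] with n hn
    rw [spectralRadius_B4 hα.le (by lia)]
    exact splitValue_pos (by lia) (by lia)
  growth := by
    have hβ : 0 ≤ 2 - 2 / α := sub_nonneg.mpr (div_le_self zero_le_two hα.le)
    filter_upwards [eventually_ge_atTop 2] with m hm
    have hsum : (m : ℝ) = (m / 2 : ℕ) + ((m + 1) / 2 : ℕ) := by exact_mod_cast (by lia)
    rw [spectralRadius_B4 hα.le hm, spectralRadius_B4 hα.le (by lia), natCast_four_sub_div,
      splitValue_comm _ ((m + 1) / 2), show (m + 1 + 1) / 2 = m / 2 + 1 by lia]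
    rw [hsum]
    exact splitValue_mul_le_splitValue_succ hβ (by lia) (by lia)
  spectralRadius_le := by
    filter_upwards [eventually_ge_atTop 4] with n hn H hH
    exact KGraph.Colorable.spectralRadius_le_B4 hH hα hn

theorem spectralRadius_B4_le {α : ℝ} (hα : 1 ≤ α) {n : ℕ} (hn : 2 ≤ n) :
    (B4 n).spectralRadius α ≤ 3 / 8 * (n : ℝ) ^ ((4 : ℕ) - (4 : ℕ) / α : ℝ) := by
  rw [spectralRadius_B4 hα hn, natCast_four_sub_div]
  refine (splitValue_le (sub_nonneg.mpr (div_le_self zero_le_two hα)) _ _).trans_eq ?_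
  rw [show n / 2 + (n + 1) / 2 = n by lia]

theorem tendsto_spectralRadius_B4_div_rpow {α : ℝ} (hα : 1 ≤ α) :
    Tendsto (fun n : ℕ => (B4 n).spectralRadius α / (n : ℝ) ^ ((4 : ℕ) - (4 : ℕ) / α : ℝ)) atTop
      (𝓝 (3 / 8)) := by
  refine (tendsto_splitValue_half_div_rpow (2 - 2 / α)).congr' ?_
  filter_upwards [eventually_ge_atTop 2] with n hn
  rw [spectralRadius_B4 hα hn, natCast_four_sub_div]

theorem theorem3p7_general (𝓕 : KFamily 4) (hstable : IsDegreeStable 𝓕 patternB4.Col) (α : ℝ)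
    (hα : 1 < α) :
    ∃ n₀ : ℕ, ∀ n > n₀, ∀ G : KGraph 4 (Fin n), G.Free 𝓕 →
      G.spectralRadius α ≤ (B4 n).spectralRadius α ∧
      (G.spectralRadius α = (B4 n).spectralRadius α ↔ G.Iso (B4 n)) := by
  have hcol : ∀ᶠ n : ℕ in atTop, ∀ H : KGraph 4 (Fin n), ⟨n, H⟩ ∈ patternB4.Col →
      H.spectralRadius α ≤ 3 / 8 * (n : ℝ) ^ ((4 : ℕ) - (4 : ℕ) / α : ℝ) := by
    filter_upwards [eventually_ge_atTop 4] with n hn H hH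
    exact (KGraph.Colorable.spectralRadius_le_B4 hH hα hn).trans
      (spectralRadius_B4_le hα.le (by lia))
  obtain ⟨n₀, hn₀⟩ := eventually_atTop.mp (hstable.eventually_spectralRadius_le hα four_ne_zero
    (isSpectralMajorant_B4 hα) (by norm_num) hcol (tendsto_spectralRadius_B4_div_rpow hα.le))
  refine ⟨max n₀ 4, fun n hn G hG => ?_⟩
  obtain ⟨hn₀n, hn4⟩ := max_lt_iff.mp hn
  obtain ⟨hle, hext⟩ := hn₀ n hn₀n.le G hG
  refine ⟨hle, fun heq => ?_, fun hiso => hiso.spectralRadius_eq α⟩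
  obtain ⟨hmem, x, hx, hpos⟩ := hext heq
  exact KGraph.Colorable.iso_B4 hmem hα hn4.le hx hpos heq

theorem theorem3p7 (𝓕 : KFamily 4) (hpair : IsTuranPair 𝓕 patternB4)
    (hstable : IsDegreeStable 𝓕 patternB4.Col) (α : ℝ) (hα : 1 < α) :
    ∃ n₀ : ℕ, ∀ n > n₀, ∀ G : KGraph 4 (Fin n), G.Free 𝓕 →
      G.spectralRadius α ≤ (B4 n).spectralRadius α ∧
      (G.spectralRadius α = (B4 n).spectralRadius α ↔ G.Iso (B4 n)) :=
  theorem3p7_general 𝓕 hstable α hα
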